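/- Let $k$ be a field, let $n\ge 2$, put $[n]=\{1,\dots,n\}$, and let $R=k[x_1,\dots,x_n]/(x_1\cdots x_n)$ be the normal crossing ring. For a ring $A$, its global dimension $\operatorname{gldim}A$ is the supremum of the projective dimensions of right $A$-modules. A finitely generated $R$-module $M$ is said to give a noncommutative resolution (NCR) of $R$ if $\operatorname{supp}M=\operatorname{supp}R$ and $\operatorname{End}_R(M)$ has finite global dimension. It gives a noncommutative crepant resolution (NCCR) of $R$ if it is finitely generated and torsion-free, $\operatorname{supp}M=\operatorname{supp}R$, and $A=\operatorname{End}_R(M)$ is a non-singular $R$-order, i.e. $\operatorname{gldim}A_{\mathfrak p}=\dim R_{\mathfrak p}$ for every $\mathfrak p\in\operatorname{Spec}R$ and $A$ is a maximal Cohen–Macaulay $R$-module. (1) Let $M=\bigoplus_{I\subseteq[n]}R/\bigl(\prod_{i\in I}x_i\bigr)$. Then $M$ gives a NCR of $R$, and $\operatorname{End}_R(M)$ has global dimension exactly $n$. Moreover, $M$ does not give a NCCR of $R$. (2) For every $K\subseteq[n]$, let $M_K=\bigoplus_{I\subseteq[n],\,I\ne K}R/\bigl(\prod_{i\in I}x_i\bigr)$.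 Then $M_K$ gives a NCR of $R$, and $\operatorname{End}_R(M_K)$ has global dimension at most $2n-1$. -/

import Mathlib

open scoped DirectSum TensorProduct

universe u

noncomputable section

namespace NormalCrossing

/-- The global dimension of a ring `A`: the supremum of the projective dimensions of all right
`A`-modules (i.e. modules over the opposite ring). For a two-sided noetherian ring this agrees with
the supremum over left modules. The zero module has projective dimension `⊥`. -/
def globalDimension (A : Type u) [Ring A] : WithBot ℕ∞ :=
  ⨆ X : ModuleCat.{u} Aᵐᵒᵖ, CategoryTheory.projectiveDimension X

/-- The depth of a module `N` over a local ring `R`: the supremum of the lengths of (weakly)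
`N`-regular sequences contained in the maximal ideal. For a nonzero finitely generated `N`, such a
sequence is automatically regular by Nakayama's lemma; the zero module has depth `⊤`. -/
def depth (R N : Type u) [CommRing R] [IsLocalRing R] [AddCommGroup N] [Module R N] : ℕ∞ :=
  ⨆ rs : {rs : List R // (∀ r ∈ rs, r ∈ IsLocalRing.maximalIdeal R) ∧
    RingTheory.Sequence.IsWeaklyRegular N rs}, (rs.1.length : ℕ∞)

/-- `N` is a maximal Cohen-Macaulay module over the noetherian ring `R`: it is finitely generated
and `depth N_p ≥ dim R_p` at every prime `p` (equality holds as soon as `N_p ≠ 0`). -/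
structure IsMCM (R N : Type u) [CommRing R] [IsNoetherianRing R] [AddCommGroup N] [Module R N] :
    Prop where
  finite : Module.Finite R N
  dim_le_depth : ∀ p : PrimeSpectrum R,
    ringKrullDim (Localization.AtPrime p.asIdeal) ≤
      (depth (Localization.AtPrime p.asIdeal)
        (LocalizedModule p.asIdeal.primeCompl N) : WithBot ℕ∞)

/-- The `R`-algebra `A` is a non-singular `R`-order: `gldim A_p = dim R_p` at every prime `p`,
where `A_p = R_p ⊗[R] A`, and `A` is maximal Cohen-Macaulay over `R`. -/
structure IsNonsingularOrder (R A : Type u) [CommRing R] [IsNoetherianRing R] [Ring A]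
    [Algebra R A] : Prop where
  globalDimension_eq : ∀ p : PrimeSpectrum R,
    globalDimension (Localization.AtPrime p.asIdeal ⊗[R] A) =
      ringKrullDim (Localization.AtPrime p.asIdeal)
  isMCM : IsMCM R A

/-- The `R`-module `M` gives a noncommutative resolution (NCR) of `R`. -/
structure IsNCR (R M : Type u) [CommRing R] [IsNoetherianRing R] [AddCommGroup M] [Module R M] :
    Prop where
  finite : Module.Finite R M
  support_eq : Module.support R M = Module.support R R
  globalDimension_lt_top : globalDimension (Module.End R M) < ⊤

/-- The `R`-module `M` gives a noncommutative crepant resolution (NCCR) of `R`. -/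
structure IsNCCR (R M : Type u) [CommRing R] [IsNoetherianRing R] [AddCommGroup M] [Module R M] :
    Prop where
  finite : Module.Finite R M
  torsionFree : Module.IsTorsionFree R M
  support_eq : Module.support R M = Module.support R R
  isNonsingularOrder : IsNonsingularOrder R (Module.End R M)

/-- The normal crossing ring `k[x₁, …, xₙ] / (x₁ ⋯ xₙ)`. -/
abbrev NCRing (k : Type u) [Field k] (n : ℕ) : Type u :=
  MvPolynomial (Fin n) k ⧸ Ideal.span {∏ i : Fin n, (MvPolynomial.X i : MvPolynomial (Fin n) k)}

/-- The class of the squarefree monomial `∏_{i ∈ I} xᵢ` in the normal crossing ring. -/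
def monomialClass (k : Type u) [Field k] (n : ℕ) (I : Finset (Fin n)) : NCRing k n :=
  Ideal.Quotient.mk _ (∏ i ∈ I, MvPolynomial.X i)

/-- The cyclic module `R / (∏_{i ∈ I} xᵢ)` over `R = k[x₁, …, xₙ] / (x₁ ⋯ xₙ)`. -/
def CyclicModule (k : Type u) [Field k] (n : ℕ) (I : Finset (Fin n)) : Type u :=
  NCRing k n ⧸ Ideal.span {monomialClass k n I}

instance (k : Type u) [Field k] (n : ℕ) (I : Finset (Fin n)) :
    AddCommGroup (CyclicModule k n I) :=
  inferInstanceAs (AddCommGroup (NCRing k n ⧸ Ideal.span {monomialClass k n I}))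

instance (k : Type u) [Field k] (n : ℕ) (I : Finset (Fin n)) :
    Module (NCRing k n) (CyclicModule k n I) :=
  inferInstanceAs (Module (NCRing k n) (NCRing k n ⧸ Ideal.span {monomialClass k n I}))

/-- The module `⨁_{I ⊆ [n]} R / (∏_{i ∈ I} xᵢ)`. -/
abbrev FullModule (k : Type u) [Field k] (n : ℕ) : Type u :=
  ⨁ I : Finset (Fin n), CyclicModule k n I

/-- The module `⨁_{I ⊆ [n], I ≠ K} R / (∏_{i ∈ I} xᵢ)`. -/
abbrev OmitModule (k : Type u) [Field k] (n : ℕ) (K : Finset (Fin n)) : Type u :=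
  ⨁ I : {I : Finset (Fin n) // I ≠ K}, CyclicModule k n I.1

end NormalCrossing

end

namespace NormalCrossing

open CategoryTheory

/-! Let P = k[t₁, …, tₙ], write t_J for the product of the t_j with j ∈ J, and make S = P/(t_[n]) an
R-algebra by xᵢ ↦ tᵢ². Sorting monomials by the set of variables with odd exponent grades S by the
subsets of [n]; the part of parity J is generated over R by t_J and is a copy of R/(x_{Jᶜ}). Hence
the full module is S (`fullRootMap_bijective`). With Q = End_R(S)ᵒᵖ, right modules over the
endomorphism ring are left Q-modules, that is, P-modules graded by (ℤ/2)ⁿ with zero component at ∅.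
`CubeRing` isolates what is needed: orthogonal idempotents e_K with Q e_K ≅ P/(t_K).

Upper bound n: a free Q-module has projective dimension at most 1 over P, and the degree-preserving
part of a P-linear lift is Q-linear. So bounds m ≥ 1 on projective dimension pass from P to Q
(`exists_average`, `pdLE_of_restrict`), and Hilbert's syzygy theorem supplies n.

Lower bound: quotients of Q e_K by variables fit into short exact sequences, each flipping one
element of K. Following them n times gives a nonzero Extⁿ into any nonzero module concentrated at
one vertex V ≠ [n] (`not_hasInjectiveDimensionLT`). Restriction along a central localization
preserves bounds on injective dimension (`baer`), so a one-dimensional module at a singleton vertex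
forces gldim A_p ≥ n at some prime p, whereas dim R_p ≤ n - 1. This excludes a crepant resolution.

Omitting K: the new opposite endomorphism ring is B = εQε with ε = 1 - e_K. Every B-module is a
summand of εX for a coinduced X, and passing from X to εX costs at most n - 1, a bound for the
projective dimension of εQ e_J over B for all J (`pdLE_corner_koszul_empty`). The total is n + (n -
1). -/

/-- The left `Q`-module `X` has projective dimension at most `n`. -/
abbrev PdLE (Q : Type u) [Ring Q] (X : Type u) [AddCommGroup X] [Module Q X] (n : ℕ) : Prop :=
  HasProjectiveDimensionLE (ModuleCat.of Q X) n

/-! ### Calculus of projective dimension -/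

section PdLE

variable {Q : Type u} [Ring Q]
variable {X Y Z : Type u} [AddCommGroup X] [Module Q X] [AddCommGroup Y] [Module Q Y]
  [AddCommGroup Z] [Module Q Z]

theorem PdLE.mono {m n : ℕ} (h : PdLE Q X m) (hmn : m ≤ n) : PdLE Q X n :=
  hasProjectiveDimensionLT_of_ge _ (m + 1) _ (by omega)

theorem pdLE_zero_iff : PdLE Q X 0 ↔ Module.Projective Q X := by
  rw [IsProjective.iff_projective]
  exact (projective_iff_hasProjectiveDimensionLE_zero _).symm

theorem pdLE_of_projective [Module.Projective Q X] (n : ℕ) : PdLE Q X n :=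
  (pdLE_zero_iff.2 inferInstance).mono n.zero_le

theorem PdLE.of_equiv {n : ℕ} (h : PdLE Q X n) (e : X ≃ₗ[Q] Y) : PdLE Q Y n :=
  hasProjectiveDimensionLT_of_iso (e.toModuleIso) _

theorem PdLE.of_retract {n : ℕ} (h : PdLE Q X n) (i : Y →ₗ[Q] X) (r : X →ₗ[Q] Y)
    (hri : r ∘ₗ i = LinearMap.id) : PdLE Q Y n :=
  Retract.hasProjectiveDimensionLT (Y := ModuleCat.of Q X)
    ⟨ModuleCat.ofHom i, ModuleCat.ofHom r, by ext x; exact LinearMap.congr_fun hri x⟩ _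

theorem PdLE.middle {f : X →ₗ[Q] Y} {g : Y →ₗ[Q] Z} (hf : Function.Injective f)
    (h : Function.Exact f g) (hg : Function.Surjective g) {n : ℕ} (hX : PdLE Q X n)
    (hZ : PdLE Q Z n) : PdLE Q Y n :=
  (ModuleCat.shortComplex_shortExact (ModuleCat.shortComplexOfCompEqZero f g
    h.linearMap_comp_eq_zero) h hf hg).hasProjectiveDimensionLT_X₂ _ hX hZ

theorem PdLE.right {f : X →ₗ[Q] Y} {g : Y →ₗ[Q] Z} (hf : Function.Injective f)
    (h : Function.Exact f g) (hg : Function.Surjective g) {n : ℕ} (hX : PdLE Q X n)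
    (hY : PdLE Q Y (n + 1)) : PdLE Q Z (n + 1) :=
  (ModuleCat.shortComplex_shortExact (ModuleCat.shortComplexOfCompEqZero f g
    h.linearMap_comp_eq_zero) h hf hg).hasProjectiveDimensionLT_X₃ _ hX hY

theorem PdLE.left {f : X →ₗ[Q] Y} {g : Y →ₗ[Q] Z} (hf : Function.Injective f)
    (h : Function.Exact f g) (hg : Function.Surjective g) {n : ℕ} (hY : PdLE Q Y n)
    (hZ : PdLE Q Z (n + 1)) : PdLE Q X n :=
  (ModuleCat.shortComplex_shortExact (ModuleCat.shortComplexOfCompEqZero f g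
    h.linearMap_comp_eq_zero) h hf hg).hasProjectiveDimensionLT_X₁ _ hY hZ

theorem PdLE.ker {g : Y →ₗ[Q] Z} (hg : Function.Surjective g) {n : ℕ} (hY : PdLE Q Y n)
    (hZ : PdLE Q Z (n + 1)) : PdLE Q (LinearMap.ker g) n :=
  hY.left (LinearMap.ker g).injective_subtype
    (LinearMap.exact_subtype_ker_map g) hg hZ

theorem PdLE.of_ker {g : Y →ₗ[Q] Z} (hg : Function.Surjective g) {n : ℕ}
    (hY : PdLE Q Y (n + 1)) (hK : PdLE Q (LinearMap.ker g) n) : PdLE Q Z (n + 1) :=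
  hK.right (LinearMap.ker g).injective_subtype (LinearMap.exact_subtype_ker_map g) hg hY

variable (Q X) in
/-- The canonical free cover of a module. -/
noncomputable def freeCover : (X →₀ Q) →ₗ[Q] X := Finsupp.linearCombination Q id

theorem freeCover_surjective : Function.Surjective (freeCover Q X) :=
  Finsupp.linearCombination_id_surjective Q X

theorem PdLE.freeCover_ker {n : ℕ} (h : PdLE Q X (n + 1)) :
    PdLE Q (LinearMap.ker (freeCover Q X)) n :=
  (pdLE_of_projective n).ker freeCover_surjective h

theorem pdLE_of_subsingleton [Subsingleton X] (n : ℕ) : PdLE Q X n := by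
  have : Module.Projective Q X := .of_equiv (default : PUnit.{u+1} ≃ₗ[Q] X)
  exact pdLE_of_projective n

theorem dfinsupp_mapRange_exact {ι : Type u} {X Y Z : ι → Type u} [∀ i, AddCommGroup (X i)]
    [∀ i, Module Q (X i)] [∀ i, AddCommGroup (Y i)] [∀ i, Module Q (Y i)]
    [∀ i, AddCommGroup (Z i)] [∀ i, Module Q (Z i)] {f : ∀ i, X i →ₗ[Q] Y i}
    {g : ∀ i, Y i →ₗ[Q] Z i} (h : ∀ i, Function.Exact (f i) (g i)) :
    Function.Exact (DFinsupp.mapRange.linearMap f) (DFinsupp.mapRange.linearMap g) := by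
  classical
  intro y
  constructor
  · intro hy
    have hy' : ∀ i, g i (y i) = 0 := fun i => by
      simpa using DFunLike.congr_fun hy i
    choose x hx using fun i => (h i (y i)).1 (hy' i)
    refine ⟨DFinsupp.mk y.support fun i => x i, ?_⟩
    ext i
    by_cases hi : i ∈ y.support
    · simp [DFinsupp.mk_of_mem hi, hx]
    · have h0 : y i = 0 := by simpa using hi
      simp [DFinsupp.mk_of_notMem hi, h0]
  · rintro ⟨x, rfl⟩
    ext i
    simpa using (h i).apply_apply_eq_zero (x i)

/-- Dimension shift along the direct sum of the free covers, starting from the projectivity of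
direct sums of projectives. -/
theorem PdLE.dfinsupp {ι : Type u} {X : ι → Type u} [∀ i, AddCommGroup (X i)]
    [∀ i, Module Q (X i)] {n : ℕ} (h : ∀ i, PdLE Q (X i) n) : PdLE Q (Π₀ i, X i) n := by
  induction n generalizing X with
  | zero =>
    have := fun i => pdLE_zero_iff.1 (h i)
    exact pdLE_of_projective 0
  | succ n ih =>
    refine PdLE.right (Y := Π₀ i, (X i →₀ Q))
      (f := DFinsupp.mapRange.linearMap fun i => (LinearMap.ker (freeCover Q (X i))).subtype)
      (g := DFinsupp.mapRange.linearMap fun i => freeCover Q (X i)) ?_ ?_ ?_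
      (ih fun i => (h i).freeCover_ker) (pdLE_of_projective _)
    · exact (DFinsupp.mapRange_injective _ fun i => map_zero _).2
        fun i => (LinearMap.ker _).injective_subtype
    · exact dfinsupp_mapRange_exact fun i => LinearMap.exact_subtype_ker_map _
    · exact (DFinsupp.mapRange_surjective _ fun i => map_zero _).2
        fun i => freeCover_surjective

end PdLE

section Base

variable {R S : Type u} [CommRing R] [CommRing S] [Algebra R S] [Module.Flat R S]

theorem PdLE.baseChange {X : Type u} [AddCommGroup X] [Module R X] {n : ℕ} (h : PdLE R X n) :
    PdLE S (S ⊗[R] X) n := by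
  induction n generalizing X with
  | zero =>
    rw [pdLE_zero_iff] at h
    exact pdLE_of_projective 0
  | succ n ih =>
    refine (ih h.freeCover_ker).right
      (f := (LinearMap.ker (freeCover R X)).subtype.baseChange S)
      (g := (freeCover R X).baseChange S) ?_ ?_ ?_ (pdLE_of_projective _)
    · exact Module.Flat.lTensor_preserves_injective_linearMap (M := S) _
        (LinearMap.ker _).injective_subtype
    · exact lTensor_exact S (LinearMap.exact_subtype_ker_map _) freeCover_surjective
    · exact LinearMap.lTensor_surjective S freeCover_surjective

end Base

/-- Projective dimension is preserved by ring isomorphisms. -/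
theorem PdLE.of_ringEquiv {Q Q' : Type u} [Ring Q] [Ring Q'] (e : Q ≃+* Q') {X X' : Type u}
    [AddCommGroup X] [Module Q X] [AddCommGroup X'] [Module Q' X'] {n : ℕ} (h : PdLE Q X n)
    (f : X ≃+ X') (hf : ∀ q x, f (q • x) = e q • f x) : PdLE Q' X' n := by
  let := RingHomInvPair.of_ringEquiv e
  let := RingHomInvPair.of_ringEquiv e.symm
  exact ModuleCat.hasProjectiveDimensionLE_of_semiLinearEquiv e
    (M := ModuleCat.of Q X) (N := ModuleCat.of Q' X')
    ({ f with map_smul' := hf } : X ≃ₛₗ[RingHomClass.toRingHom e] X') n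

end NormalCrossing

namespace NormalCrossing

/-! ### Hilbert's syzygy theorem -/

section Polynomial

open Polynomial

variable {R M : Type u} [CommRing R] [AddCommGroup M] [Module R M]

variable (R M) in
/-- The coefficients of an element of `R[X] ⊗ M`. -/
noncomputable def tensorCoeff (j : ℕ) : R[X] ⊗[R] M →ₗ[R] M :=
  TensorProduct.lift ((LinearMap.lsmul R M) ∘ₗ Polynomial.lcoeff R j)

@[simp]
theorem tensorCoeff_tmul (j : ℕ) (p : R[X]) (m : M) :
    tensorCoeff R M j (p ⊗ₜ m) = p.coeff j • m := by
  simp [tensorCoeff]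

theorem exists_tensorCoeff_eq_zero (z : R[X] ⊗[R] M) :
    ∃ N, ∀ j, N ≤ j → tensorCoeff R M j z = 0 := by
  induction z with
  | zero => simp
  | add x y hx hy =>
    obtain ⟨a, ha⟩ := hx
    obtain ⟨b, hb⟩ := hy
    exact ⟨max a b, fun j hj => by
      simp [ha j (le_trans (le_max_left _ _) hj), hb j (le_trans (le_max_right _ _) hj)]⟩
  | tmul p m =>
    exact ⟨p.natDegree + 1, fun j hj => by
      simp [Polynomial.coeff_eq_zero_of_natDegree_lt (Nat.lt_of_succ_le hj)]⟩

theorem eq_sum_tensorCoeff (z : R[X] ⊗[R] M) (N : ℕ)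
    (hN : ∀ j, N ≤ j → tensorCoeff R M j z = 0) :
    z = ∑ j ∈ Finset.range N, (X ^ j : R[X]) ⊗ₜ tensorCoeff R M j z := by
  have key : ∃ N₀, ∀ N, N₀ ≤ N →
      z = ∑ j ∈ Finset.range N, (X ^ j : R[X]) ⊗ₜ tensorCoeff R M j z := by
    clear hN
    induction z with
    | zero => exact ⟨0, by simp⟩
    | add x y hx hy =>
      obtain ⟨a, ha⟩ := hx
      obtain ⟨b, hb⟩ := hy
      refine ⟨max a b, fun N hN => ?_⟩
      simp only [map_add, TensorProduct.tmul_add, Finset.sum_add_distrib]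
      rw [← ha N (le_trans (le_max_left _ _) hN), ← hb N (le_trans (le_max_right _ _) hN)]
    | tmul p m =>
      refine ⟨p.natDegree + 1, fun N hN => ?_⟩
      conv_lhs => rw [p.as_sum_range_C_mul_X_pow' (Nat.lt_of_succ_le hN)]
      simp [TensorProduct.sum_tmul, ← smul_eq_C_mul, TensorProduct.smul_tmul]
  obtain ⟨N₀, h⟩ := key
  rw [Finset.sum_subset (Finset.range_mono (le_max_left N N₀))]
  · exact h _ (le_max_right _ _)
  · intro j _ hj
    rw [hN j (by simpa using hj), TensorProduct.tmul_zero]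

variable [Module R[X] M] [IsScalarTower R R[X] M]

variable (R M) in
/-- The endomorphism `p ⊗ m ↦ X p ⊗ m - p ⊗ X m` of `R[X] ⊗ M`. -/
noncomputable def characteristicMap : R[X] ⊗[R] M →ₗ[R[X]] R[X] ⊗[R] M :=
  LinearMap.lsmul R[X] (R[X] ⊗[R] M) X -
    LinearMap.baseChange R[X] ((LinearMap.lsmul R[X] M X).restrictScalars R)

@[simp]
theorem characteristicMap_tmul (p : R[X]) (m : M) :
    characteristicMap R M (p ⊗ₜ m) = (X * p) ⊗ₜ m - p ⊗ₜ ((X : R[X]) • m) := by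
  simp [characteristicMap, TensorProduct.smul_tmul']

variable (R M) in
/-- The action map `R[X] ⊗ M → M`. -/
noncomputable def actionMap : R[X] ⊗[R] M →ₗ[R[X]] M :=
  LinearMap.liftBaseChange R[X] LinearMap.id

@[simp]
theorem actionMap_tmul (p : R[X]) (m : M) : actionMap R M (p ⊗ₜ m) = p • m := by
  simp [actionMap]

theorem actionMap_surjective : Function.Surjective (actionMap R M) :=
  fun m => ⟨1 ⊗ₜ m, by simp⟩

/-- Modulo the range, X p ⊗ m equals p ⊗ X m, so every power of X moves to the right factor. This is
the nontrivial half of exactness. -/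
theorem sub_one_tmul_mem_range (z : R[X] ⊗[R] M) :
    z - 1 ⊗ₜ actionMap R M z ∈ LinearMap.range (characteristicMap R M) := by
  induction z with
  | zero => simp
  | add x y hx hy =>
    rw [map_add, TensorProduct.tmul_add, add_sub_add_comm]
    exact add_mem hx hy
  | tmul p m =>
    induction p using Polynomial.induction_on' with
    | add p q hp hq =>
      rw [TensorProduct.add_tmul, map_add, TensorProduct.tmul_add, add_sub_add_comm]
      exact add_mem hp hq
    | monomial i a =>
      induction i generalizing m with
      | zero =>
        rw [actionMap_tmul, monomial_zero_left, ← mul_one (C a), ← smul_eq_C_mul, smul_assoc,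
          one_smul, TensorProduct.smul_tmul, sub_self]
        exact zero_mem _
      | succ i ih =>
        have h := add_mem (LinearMap.mem_range_self (characteristicMap R M)
          (monomial i a ⊗ₜ m)) (ih ((X : R[X]) • m))
        simpa [← mul_smul, monomial_mul_X, X_mul_monomial] using h

theorem characteristicMap_exact :
    Function.Exact (characteristicMap R M) (actionMap R M) := by
  intro z
  constructor
  · intro hz
    simpa [hz] using sub_one_tmul_mem_range z
  · rintro ⟨w, rfl⟩
    induction w with
    | zero => simp
    | add x y hx hy => simp [hx, hy]
    | tmul p m => simp [mul_smul, smul_comm p (X : R[X]) m]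

theorem characteristicMap_injective : Function.Injective (characteristicMap R M) := by
  rw [injective_iff_map_eq_zero]
  intro z hz
  have hrec : ∀ (w : R[X] ⊗[R] M) (j : ℕ), tensorCoeff R M (j + 1) (characteristicMap R M w) =
      tensorCoeff R M j w - (X : R[X]) • tensorCoeff R M (j + 1) w := by
    intro w j
    induction w with
    | zero => simp
    | add x y hx hy => rw [map_add, map_add, hx, hy, map_add, map_add, smul_add]; abel
    | tmul p m =>
      simp only [characteristicMap_tmul, map_sub, tensorCoeff_tmul, coeff_X_mul]
      rw [smul_comm (X : R[X])]
  obtain ⟨N, hN⟩ := exists_tensorCoeff_eq_zero z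
  -- On the kernel, the j-th coefficient is X times the (j+1)-st; since high coefficients vanish,
  -- descent kills all of them.
  have hcoeff : ∀ i j, N ≤ j + i → tensorCoeff R M j z = 0 := by
    intro i
    induction i with
    | zero => exact hN
    | succ i ih =>
      intro j hj
      have h := hrec z j
      rw [hz, map_zero, ih (j + 1) (by omega), smul_zero, sub_zero] at h
      exact h.symm
  rw [eq_sum_tensorCoeff z 0 fun j _ => hcoeff N j (by omega)]
  simp

/-- The sequence 0 → M[X] → M[X] → M → 0 given by `characteristicMap` and `actionMap` costs one
dimension, and M[X] inherits the bound by flat base change. -/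
theorem PdLE.polynomial {n : ℕ} (h : PdLE R M n) : PdLE R[X] M (n + 1) :=
  (h.baseChange (S := R[X])).right characteristicMap_injective characteristicMap_exact
    actionMap_surjective (h.baseChange.mono n.le_succ)

end Polynomial

/-- Every module over the polynomial ring in `n` variables over a field has projective dimension
at most `n`. -/
theorem pdLE_mvPolynomial (k : Type u) [Field k] (n : ℕ) (M : Type u) [AddCommGroup M]
    [Module (MvPolynomial (Fin n) k) M] : PdLE (MvPolynomial (Fin n) k) M n := by
  induction n generalizing M with
  | zero =>
    let e : k ≃+* MvPolynomial (Fin 0) k := (MvPolynomial.isEmptyRingEquiv k (Fin 0)).symm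
    let : Module k M := Module.compHom M e.toRingHom
    have h : PdLE k M 0 := pdLE_of_projective 0
    exact h.of_ringEquiv e (AddEquiv.refl M) fun q x => rfl
  | succ n ih =>
    let e : Polynomial (MvPolynomial (Fin n) k) ≃+* MvPolynomial (Fin (n + 1)) k :=
      (MvPolynomial.finSuccEquiv k n).symm.toRingEquiv
    let : Module (Polynomial (MvPolynomial (Fin n) k)) M := Module.compHom M e.toRingHom
    let : Module (MvPolynomial (Fin n) k) M :=
      Module.compHom M (Polynomial.C : _ →+* Polynomial (MvPolynomial (Fin n) k))
    have : IsScalarTower (MvPolynomial (Fin n) k) (Polynomial (MvPolynomial (Fin n) k)) M :=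
      ⟨fun a p m => by
        rw [Polynomial.smul_eq_C_mul, mul_smul]; rfl⟩
    exact (ih M).polynomial.of_ringEquiv e (AddEquiv.refl M) fun q x => rfl

end NormalCrossing

open scoped symmDiff

namespace NormalCrossing

/-! ### The parity grading of the polynomial ring -/

section Parity

open MvPolynomial

variable {k : Type u} [Field k] {n : ℕ}

/-- The set of variables occurring with odd exponent in a monomial. -/
def parity (α : Fin n →₀ ℕ) : Finset (Fin n) := Finset.univ.filter fun i => Odd (α i)

@[simp]
theorem mem_parity {α : Fin n →₀ ℕ} {i : Fin n} : i ∈ parity α ↔ Odd (α i) := by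
  simp [parity]

theorem parity_add (α β : Fin n →₀ ℕ) : parity (α + β) = parity α ∆ parity β := by
  ext i
  simp only [mem_parity, Finset.mem_symmDiff, Finsupp.add_apply, Nat.odd_add, Nat.not_odd_iff_even]
  grind

/-- The component of a polynomial spanned by the monomials of parity `I`. -/
noncomputable def parityPart (I : Finset (Fin n)) :
    MvPolynomial (Fin n) k →ₗ[k] MvPolynomial (Fin n) k :=
  (basisMonomials (Fin n) k).constr k fun α => if parity α = I then monomial α 1 else 0

theorem parityPart_monomial (I : Finset (Fin n)) (α : Fin n →₀ ℕ) (a : k) :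
    parityPart I (monomial α a) = if parity α = I then monomial α a else 0 := by
  have h : (monomial α a : MvPolynomial (Fin n) k) = a • basisMonomials (Fin n) k α := by
    simp [smul_monomial]
  rw [h, map_smul, parityPart, Module.Basis.constr_basis]
  split_ifs <;> simp

theorem coeff_parityPart (I : Finset (Fin n)) (α : Fin n →₀ ℕ) (p : MvPolynomial (Fin n) k) :
    coeff α (parityPart I p) = if parity α = I then coeff α p else 0 := by
  induction p using MvPolynomial.induction_on' with
  | monomial β a =>
    rw [parityPart_monomial]
    by_cases h : β = α
    · subst h
      split_ifs <;> simp
    · split_ifs <;> simp [coeff_monomial, h]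
  | add p q hp hq =>
    rw [map_add, coeff_add, hp, hq, coeff_add]
    split_ifs <;> simp

theorem sum_parityPart (p : MvPolynomial (Fin n) k) : ∑ I, parityPart I p = p := by
  ext α
  simp [coeff_sum, coeff_parityPart]

theorem parityPart_parityPart (I J : Finset (Fin n)) (p : MvPolynomial (Fin n) k) :
    parityPart I (parityPart J p) = if I = J then parityPart J p else 0 := by
  ext α
  simp only [coeff_parityPart]
  split_ifs with h1 h2 h3 h4 <;> simp_all [coeff_parityPart]

theorem parityPart_monomial_mul (I : Finset (Fin n)) (α : Fin n →₀ ℕ) (a : k)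
    (p : MvPolynomial (Fin n) k) :
    parityPart I (monomial α a * p) = monomial α a * parityPart (I ∆ parity α) p := by
  induction p using MvPolynomial.induction_on' with
  | monomial β b =>
    rw [monomial_mul, parityPart_monomial, parityPart_monomial, parity_add]
    have : parity α ∆ parity β = I ↔ parity β = I ∆ parity α := by
      rw [symmDiff_comm I, ← symmDiff_right_inj (a := parity α) (b := parity β),
        symmDiff_symmDiff_cancel_left]
    simp only [this]
    split_ifs <;> simp [monomial_mul]
  | add p q hp hq => rw [mul_add, map_add, map_add, hp, hq, mul_add]

theorem parity_single_one (i : Fin n) : parity (Finsupp.single i 1) = {i} := by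
  ext j
  by_cases h : i = j
  · simp [h]
  · simp [Ne.symm h]

theorem parityPart_X_mul (I : Finset (Fin n)) (i : Fin n) (p : MvPolynomial (Fin n) k) :
    parityPart I (X i * p) = X i * parityPart (I ∆ {i}) p := by
  rw [X, parityPart_monomial_mul, parity_single_one]

theorem parityPart_C_mul (I : Finset (Fin n)) (a : k) (p : MvPolynomial (Fin n) k) :
    parityPart I (C a * p) = C a * parityPart I p := by
  rw [C_mul', C_mul', map_smul]

variable (k) in
/-- The squarefree monomial with support `K`. -/
noncomputable def squarefreeMonomial (K : Finset (Fin n)) : MvPolynomial (Fin n) k :=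
  ∏ i ∈ K, X i

/-- The exponent of the squarefree monomial with support `K`. -/
noncomputable def squarefreeExponent (K : Finset (Fin n)) : Fin n →₀ ℕ :=
  Finsupp.indicator K fun _ _ => 1

@[simp]
theorem squarefreeExponent_apply (K : Finset (Fin n)) (i : Fin n) :
    squarefreeExponent K i = if i ∈ K then 1 else 0 := by
  simp [squarefreeExponent, Finsupp.indicator_apply]

theorem parity_squarefreeExponent (K : Finset (Fin n)) : parity (squarefreeExponent K) = K := by
  ext i
  by_cases h : i ∈ K <;> simp [h]

theorem squarefreeMonomial_eq_monomial (K : Finset (Fin n)) :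
    squarefreeMonomial k K = monomial (squarefreeExponent K) 1 := by
  rw [monomial_eq, squarefreeMonomial, map_one, one_mul, Finsupp.prod_fintype _ _ (by simp)]
  simp [Finset.prod_ite_mem]

theorem squarefreeMonomial_ne_zero (K : Finset (Fin n)) : squarefreeMonomial k K ≠ 0 := by
  simp [squarefreeMonomial_eq_monomial]

@[simp]
theorem squarefreeMonomial_empty : squarefreeMonomial k (∅ : Finset (Fin n)) = 1 := by
  simp [squarefreeMonomial]

theorem parityPart_squarefreeMonomial_mul (I K : Finset (Fin n)) (p : MvPolynomial (Fin n) k) :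
    parityPart I (squarefreeMonomial k K * p) =
      squarefreeMonomial k K * parityPart (I ∆ K) p := by
  rw [squarefreeMonomial_eq_monomial, parityPart_monomial_mul, parity_squarefreeExponent]

theorem parityPart_one (I : Finset (Fin n)) :
    parityPart I (1 : MvPolynomial (Fin n) k) = if I = ∅ then 1 else 0 := by
  have h : parity (0 : Fin n →₀ ℕ) = ∅ := by ext i; simp
  rw [← C_1, ← monomial_zero', parityPart_monomial, h]
  simp only [eq_comm]

/-- Divisibility by a monomial can be tested on each monomial separately; annihilators below are
computed this way. -/
theorem squarefreeMonomial_dvd_iff (K : Finset (Fin n)) (p : MvPolynomial (Fin n) k) :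
    squarefreeMonomial k K ∣ p ↔ ∀ α, coeff α p ≠ 0 → ∀ i ∈ K, α i ≠ 0 := by
  rw [squarefreeMonomial_eq_monomial]
  constructor
  · rintro ⟨q, rfl⟩ α hα i hi h0
    rw [coeff_monomial_mul'] at hα
    split_ifs at hα with h
    · have := h i
      simp [hi, h0] at this
    · exact hα rfl
  · intro h
    have : p = ∑ α ∈ p.support, monomial α (coeff α p) := (support_sum_monomial_coeff p).symm
    rw [this]
    refine Finset.dvd_sum fun α hα => ?_
    refine monomial_dvd_monomial.2 ⟨Or.inr fun i => ?_, one_dvd _⟩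
    have := h α (mem_support_iff.1 hα) i
    by_cases hi : i ∈ K
    · simpa [hi, Nat.one_le_iff_ne_zero] using this hi
    · simp [hi]

end Parity

/-! ### Cube rings -/

open MvPolynomial in
/-- The structure on a ring `Q` that makes `Q`-modules into modules over `k[t₁, …, tₙ]` that are
graded by the group `(ℤ/2)ⁿ` of subsets of `Fin n` and have vanishing component at `∅`. -/
structure CubeRing (k : Type u) [Field k] (n : ℕ) (Q : Type u) [Ring Q] where
  ψ : MvPolynomial (Fin n) k →+* Q
  e : Finset (Fin n) → Q
  e_mul_e : ∀ I J, e I * e J = if I = J then e J else 0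
  sum_e : ∑ I, e I = 1
  C_mul_e : ∀ a K, ψ (C a) * e K = e K * ψ (C a)
  X_mul_e : ∀ i K, ψ (X i) * e K = e (K ∆ {i}) * ψ (X i)
  -- Together with the next field this says Q e_K ≅ P/(t_K). Since t_∅ = 1, it forces e_∅ = 0.
  exists_mul_e : ∀ q K, ∃ p, q * e K = ψ p * e K
  ψ_mul_e_eq_zero : ∀ p K, ψ p * e K = 0 ↔ squarefreeMonomial k K ∣ p

namespace CubeRing

open MvPolynomial

variable {k : Type u} [Field k] {n : ℕ} {Q : Type u} [Ring Q] (D : CubeRing k n Q)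

include D

theorem e_empty : D.e ∅ = 0 := by
  simpa using (D.ψ_mul_e_eq_zero 1 ∅).2 (by simp)

/-- A polynomial of parity L moves degree K to K ∆ L, so e_I selects exactly the part of parity I ∆
K. -/
theorem e_mul_ψ_mul_e (I K : Finset (Fin n)) (p : MvPolynomial (Fin n) k) :
    D.e I * (D.ψ p * D.e K) = D.ψ (parityPart (I ∆ K) p) * D.e K := by
  induction p using MvPolynomial.induction_on generalizing K with
  | C a =>
    rw [← mul_one (C a), parityPart_C_mul, parityPart_one, mul_one, D.C_mul_e, ← mul_assoc,
      D.e_mul_e]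
    by_cases h : I = K
    · simp [h, D.C_mul_e]
    · have : I ∆ K ≠ ∅ := fun h' => h (symmDiff_eq_bot.1 h')
      simp [h, this]
  | add p q hp hq => rw [map_add, add_mul, mul_add, hp, hq, map_add, map_add, add_mul]
  | mul_X p i hp =>
    rw [mul_comm p, parityPart_X_mul, mul_comm (X i), mul_comm (X i), map_mul, map_mul, mul_assoc,
      mul_assoc, D.X_mul_e, ← mul_assoc (D.ψ p), ← mul_assoc (D.e I), hp, mul_assoc,
      symmDiff_assoc]

theorem eq_sum_mul_e (q : Q) : q = ∑ K, q * D.e K := by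
  rw [← Finset.mul_sum, D.sum_e, mul_one]

end CubeRing

/-- The restriction of a module along a ring homomorphism. -/
def Restrict {P Q : Type u} [Ring P] [Ring Q] (_ : P →+* Q) (X : Type u) : Type u := X

namespace Restrict

variable {P Q : Type u} [Ring P] [Ring Q] (f : P →+* Q) {X Y : Type u}
  [AddCommGroup X] [Module Q X] [AddCommGroup Y] [Module Q Y]

instance : AddCommGroup (Restrict f X) := inferInstanceAs (AddCommGroup X)

instance : Module P (Restrict f X) := Module.compHom X f

variable (X) in
/-- The identity map from a module to its restriction. -/
def of : X ≃+ Restrict f X := AddEquiv.refl X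

theorem smul_of (p : P) (x : X) : p • of f X x = of f X (f p • x) := rfl

/-- The restriction of a linear map. -/
def map (g : X →ₗ[Q] Y) : Restrict f X →ₗ[P] Restrict f Y where
  toFun x := of f Y (g ((of f X).symm x))
  map_add' x y := by simp
  map_smul' p x := by
    obtain ⟨x, rfl⟩ := (of f X).surjective x
    simp [smul_of]

theorem map_surjective {g : X →ₗ[Q] Y} (h : Function.Surjective g) :
    Function.Surjective (map f g) := h

/-- The kernel of a restricted map is the restriction of the kernel. -/
def kerEquiv (g : X →ₗ[Q] Y) :
    LinearMap.ker (map f g) ≃ₗ[P] Restrict f (LinearMap.ker g) where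
  toFun x := of f _ ⟨(of f X).symm x.1, x.2⟩
  invFun y := ⟨of f X ((of f _).symm y).1, ((of f _).symm y).2⟩
  map_add' _ _ := rfl
  map_smul' _ _ := rfl
  left_inv _ := rfl
  right_inv _ := rfl

end Restrict

end NormalCrossing

/-! ### Graded covers and descent of projective dimension from P to Q -/

namespace NormalCrossing

namespace CubeRing

open MvPolynomial

variable {k : Type u} [Field k] {n : ℕ} {Q : Type u} [Ring Q] (D : CubeRing k n Q)
variable (X : Type u)

/-- The free `k[t₁, …, tₙ]`-module covering the free `Q`-module on `X`. -/
abbrev GradedCover (k : Type u) [Field k] (n : ℕ) (X : Type u) : Type u :=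
  (Finset (Fin n) × X) →₀ MvPolynomial (Fin n) k

/-- The covering map, sending the basis element `(K, x)` to `e_K` in the copy of `Q` at `x`. -/
noncomputable def cover (X : Type u) :
    GradedCover k n X →ₗ[MvPolynomial (Fin n) k] Restrict D.ψ (X →₀ Q) :=
  Finsupp.linearCombination _ fun z => Restrict.of D.ψ _ (Finsupp.single z.2 (D.e z.1))

theorem cover_apply (v : GradedCover k n X) (x : X) :
    (Restrict.of D.ψ _).symm (D.cover X v) x = ∑ K, D.ψ (v (K, x)) * D.e K := by
  classical
  induction v using Finsupp.induction_linear with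
  | zero => simp
  | add v w hv hw =>
    simp only [map_add, Finsupp.add_apply, add_mul, Finset.sum_add_distrib, hv, hw]
  | single z p =>
    obtain ⟨K, y⟩ := z
    simp only [cover, Finsupp.linearCombination_single, Restrict.smul_of, AddEquiv.symm_apply_apply]
    by_cases h : y = x
    · subst h
      rw [Finset.sum_eq_single K]
      · simp
      · intro J _ hJ
        rw [Finsupp.single_eq_of_ne (by simp [hJ])]; simp
      · simp
    · rw [Finset.sum_eq_zero]
      · simp [Finsupp.single_eq_of_ne (Ne.symm h)]
      · intro J _
        rw [Finsupp.single_eq_of_ne (by simp [Ne.symm h])]; simp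

theorem cover_eq_zero_iff (v : GradedCover k n X) :
    D.cover X v = 0 ↔ ∀ K x, squarefreeMonomial k K ∣ v (K, x) := by
  rw [← (Restrict.of D.ψ _).symm.map_eq_zero_iff, Finsupp.ext_iff]
  simp only [cover_apply, Finsupp.zero_apply]
  rw [forall_comm]
  refine forall_congr' fun x => ⟨fun h K => ?_, fun h => ?_⟩
  · rw [← D.ψ_mul_e_eq_zero]
    -- Right multiplication by e_K isolates the K-th summand.
    have := congrArg (· * D.e K) h
    simpa [Finset.sum_mul, mul_assoc, D.e_mul_e] using this
  · exact Finset.sum_eq_zero fun K _ => (D.ψ_mul_e_eq_zero _ K).2 (h K)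

theorem cover_surjective : Function.Surjective (D.cover X) := by
  intro y
  obtain ⟨y, rfl⟩ := (Restrict.of D.ψ _).surjective y
  induction y using Finsupp.induction_linear with
  | zero => exact ⟨0, by simp⟩
  | add y z hy hz =>
    obtain ⟨v, hv⟩ := hy
    obtain ⟨w, hw⟩ := hz
    exact ⟨v + w, by simp [hv, hw]⟩
  | single x q =>
    choose p hp using fun K => D.exists_mul_e q K
    refine ⟨∑ K, Finsupp.single (K, x) (p K), ?_⟩
    rw [map_sum, D.eq_sum_mul_e q, Finsupp.single_finsetSum, map_sum]
    refine Finset.sum_congr rfl fun K _ => ?_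
    simp [cover, Restrict.smul_of, hp]

/-- The embedding of the relations of the covering map. -/
noncomputable def coverRelation (k : Type u) [Field k] (n : ℕ) (X : Type u) :
    GradedCover k n X →ₗ[MvPolynomial (Fin n) k] GradedCover k n X :=
  Finsupp.linearCombination _ fun z => Finsupp.single z (squarefreeMonomial k z.1)

theorem coverRelation_apply (v : GradedCover k n X) (z : Finset (Fin n) × X) :
    coverRelation k n X v z = v z * squarefreeMonomial k z.1 := by
  classical
  induction v using Finsupp.induction_linear with
  | zero => simp
  | add v w hv hw => simp [hv, hw, add_mul]
  | single y p =>
    by_cases h : y = z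
    · subst h; simp [coverRelation]
    · simp [coverRelation, Finsupp.single_eq_of_ne (Ne.symm h)]

theorem coverRelation_injective : Function.Injective (coverRelation k n X) := by
  intro v w h
  ext1 z
  have := DFunLike.congr_fun h z
  rw [coverRelation_apply, coverRelation_apply] at this
  exact mul_right_cancel₀ (squarefreeMonomial_ne_zero _) this

theorem coverRelation_exact : Function.Exact (coverRelation k n X) (D.cover X) := by
  classical
  intro v
  rw [cover_eq_zero_iff]
  constructor
  · intro h
    choose w hw using h
    refine ⟨Finsupp.onFinset v.support (fun z => w z.1 z.2) fun z hz => ?_, ?_⟩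
    · rw [Finsupp.mem_support_iff]
      intro h0
      have := hw z.1 z.2
      rw [Prod.mk.eta, h0] at this
      exact (mul_ne_zero (squarefreeMonomial_ne_zero _) hz) this.symm
    · ext1 z
      rw [coverRelation_apply, Finsupp.onFinset_apply, mul_comm, ← hw]
  · rintro ⟨w, rfl⟩ K x
    rw [coverRelation_apply]
    exact Dvd.intro_left _ rfl

/-- Over P a free Q-module is a direct sum of modules P/(t_K), each with the length-one resolution
given by multiplication by t_K ≠ 0. -/
theorem pdLE_restrict_free :
    PdLE (MvPolynomial (Fin n) k) (Restrict D.ψ (X →₀ Q)) 1 :=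
  (pdLE_of_projective 0).right (coverRelation_injective X) (D.coverRelation_exact X)
    (D.cover_surjective X) (pdLE_of_projective 1)

/-- The component of degree `I` of an element of the graded cover. -/
noncomputable def coverPart (k : Type u) [Field k] (n : ℕ) (X : Type u) (I : Finset (Fin n)) :
    GradedCover k n X →+ GradedCover k n X :=
  Finsupp.liftAddHom fun z => (Finsupp.singleAddHom z).comp
    (parityPart (I ∆ z.1)).toAddMonoidHom

theorem coverPart_single (I : Finset (Fin n)) (z : Finset (Fin n) × X)
    (p : MvPolynomial (Fin n) k) :
    coverPart k n X I (Finsupp.single z p) = Finsupp.single z (parityPart (I ∆ z.1) p) := by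
  simp [coverPart]

theorem cover_coverPart (I : Finset (Fin n)) (v : GradedCover k n X) :
    (Restrict.of D.ψ _).symm (D.cover X (coverPart k n X I v)) =
      D.e I • (Restrict.of D.ψ _).symm (D.cover X v) := by
  induction v using Finsupp.induction_linear with
  | zero => simp
  | add v w hv hw => simp only [map_add, smul_add, hv, hw]
  | single z p =>
    simp only [coverPart_single, cover, Finsupp.linearCombination_single, Restrict.smul_of,
      AddEquiv.symm_apply_apply, Finsupp.smul_single, smul_eq_mul, D.e_mul_ψ_mul_e]

theorem coverPart_X_smul (I : Finset (Fin n)) (i : Fin n) (v : GradedCover k n X) :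
    coverPart k n X I ((MvPolynomial.X i : MvPolynomial (Fin n) k) • v) =
      (MvPolynomial.X i : MvPolynomial (Fin n) k) • coverPart k n X (I ∆ {i}) v := by
  induction v using Finsupp.induction_linear with
  | zero => simp
  | add v w hv hw => simp only [smul_add, map_add, hv, hw]
  | single z p =>
    simp only [Finsupp.smul_single, coverPart_single, smul_eq_mul, parityPart_X_mul,
      symmDiff_right_comm]

theorem coverPart_C_smul (I : Finset (Fin n)) (a : k) (v : GradedCover k n X) :
    coverPart k n X I ((C a : MvPolynomial (Fin n) k) • v) =
      (C a : MvPolynomial (Fin n) k) • coverPart k n X I v := by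
  induction v using Finsupp.induction_linear with
  | zero => simp
  | add v w hv hw => simp only [smul_add, map_add, hv, hw]
  | single z p =>
    simp only [Finsupp.smul_single, coverPart_single, smul_eq_mul, parityPart_C_mul]

theorem coverPart_coverPart (I J : Finset (Fin n)) (v : GradedCover k n X) :
    coverPart k n X I (coverPart k n X J v) = if I = J then coverPart k n X J v else 0 := by
  induction v using Finsupp.induction_linear with
  | zero => simp
  | add v w hv hw =>
    simp only [map_add, hv, hw]
    split_ifs <;> simp
  | single z p =>
    simp only [coverPart_single, parityPart_parityPart, symmDiff_left_inj]
    split_ifs <;> simp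

/-- The relation t_K on a generator of degree K has degree K ∆ K = ∅. As e_∅ = 0, averaged maps will
therefore kill all relations. -/
theorem coverPart_coverRelation_single (I : Finset (Fin n)) (z : Finset (Fin n) × X) (hI : I ≠ ∅) :
    coverPart k n X I (coverRelation k n X (Finsupp.single z 1)) = 0 := by
  have h := parityPart_squarefreeMonomial_mul (k := k) (I ∆ z.1) z.1 1
  rw [symmDiff_symmDiff_cancel_right, parityPart_one, mul_one, if_neg hI, mul_zero] at h
  simp [coverRelation, coverPart_single, h]

section Averaging

variable {X} {M N : Type u} [AddCommGroup M] [Module Q M] [AddCommGroup N] [Module Q N]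

/-- Let `L` be a graded submodule of the graded cover containing its relations, with image `N` in
the free module. A linear map from `L` to a `Q`-module averages to a `Q`-linear map on `N`. -/
theorem exists_average (L : Submodule (MvPolynomial (Fin n) k) (GradedCover k n X))
    (hL : ∀ I, ∀ v ∈ L, coverPart k n X I v ∈ L)
    (hL' : ∀ v, D.cover X v = 0 → v ∈ L)
    (j : N →ₗ[Q] (X →₀ Q))
    (hjN : ∀ y, ∃ v ∈ L, j y = (Restrict.of D.ψ _).symm (D.cover X v))
    (s : L →ₗ[MvPolynomial (Fin n) k] Restrict D.ψ M) :
    ∃ σ : N →ₗ[Q] M, ∀ (v : L) (y : N), j y = (Restrict.of D.ψ _).symm (D.cover X v) →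
      σ y = ∑ I, D.e I • (Restrict.of D.ψ M).symm (s ⟨coverPart k n X I v, hL I v v.2⟩) := by
  obtain ⟨c, hc⟩ : ∃ c : Finset (Fin n) → L →+ L,
      ∀ I (v : L), ((c I v : L) : GradedCover k n X) = coverPart k n X I v :=
    ⟨fun I => ((coverPart k n X I).comp L.subtype.toAddMonoidHom).codRestrict L.toAddSubgroup
      fun v => hL I v v.2, fun _ _ => rfl⟩
  have hc' : ∀ I (v : L), (⟨coverPart k n X I v, hL I v v.2⟩ : L) = c I v :=
    fun I v => Subtype.ext (hc I v).symm
  simp only [hc']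
  obtain ⟨s', hs'', hs'⟩ : ∃ s' : L →+ M, (∀ v, (Restrict.of D.ψ M).symm (s v) = s' v) ∧
      ∀ (p : MvPolynomial (Fin n) k) v, s' (p • v) = D.ψ p • s' v :=
    ⟨(Restrict.of D.ψ M).symm.toAddMonoidHom.comp s.toAddMonoidHom, fun _ => rfl, fun p v => by
      change (Restrict.of D.ψ M).symm (s (p • v)) = _
      rw [map_smul]; rfl⟩
  simp only [hs'']
  -- The degree-preserving part of s': the I-part is sent to the I-component of its value. No
  -- division by 2ⁿ occurs, so the characteristic of k is irrelevant.
  obtain ⟨s₀, hs₀⟩ : ∃ s₀ : L →+ M, ∀ v, s₀ v = ∑ I, D.e I • s' (c I v) :=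
    ⟨∑ I, (DistribSMul.toAddMonoidHom M (D.e I)).comp (s'.comp (c I)), fun v => by simp⟩
  have hsmul : ∀ p v, s₀ (p • v) = D.ψ p • s₀ v := by
    intro p
    induction p using MvPolynomial.induction_on with
    | C a =>
      intro v
      rw [hs₀, hs₀, Finset.smul_sum]
      refine Finset.sum_congr rfl fun I _ => ?_
      have : c I ((C a : MvPolynomial (Fin n) k) • v) = (C a : MvPolynomial (Fin n) k) • c I v :=
        Subtype.ext (by rw [hc, Submodule.coe_smul, Submodule.coe_smul, hc, coverPart_C_smul])
      rw [this, hs', ← mul_smul, ← mul_smul, D.C_mul_e]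
    | add p q hp hq => intro v; rw [add_smul, map_add, hp, hq, map_add, add_smul]
    | mul_X p i hp =>
      intro v
      rw [mul_smul, hp, map_mul, mul_smul]
      congr 1
      rw [hs₀, hs₀, Finset.smul_sum]
      -- Multiplication by tᵢ shifts degrees by {i}, so both sides agree after reindexing.
      refine Fintype.sum_equiv ⟨(· ∆ {i}), (· ∆ {i}), fun I => symmDiff_symmDiff_cancel_right _ _,
        fun I => symmDiff_symmDiff_cancel_right _ _⟩ _ _ fun I => ?_
      have : c I ((MvPolynomial.X i : MvPolynomial (Fin n) k) • v) =
          (MvPolynomial.X i : MvPolynomial (Fin n) k) • c (I ∆ {i}) v :=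
        Subtype.ext (by rw [hc, Submodule.coe_smul, Submodule.coe_smul, hc, coverPart_X_smul])
      rw [this, hs', ← mul_smul, ← mul_smul, Equiv.coe_fn_mk, D.X_mul_e,
        symmDiff_symmDiff_cancel_right]
  have he : ∀ J v, s₀ (c J v) = D.e J • s₀ v := by
    intro J v
    rw [hs₀, hs₀, Finset.smul_sum]
    refine Finset.sum_congr rfl fun I _ => ?_
    have : c I (c J v) = if I = J then c J v else 0 := by
      apply Subtype.ext
      rw [hc, hc, coverPart_coverPart]
      split_ifs
      · exact (hc J v).symm
      · rfl
    rw [this, ← mul_smul, D.e_mul_e]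
    split_ifs with h1 h2 h2
    · rw [h1]
    · exact absurd h1.symm h2
    · exact absurd h2.symm h1
    · simp
  have hmem : ∀ w, coverRelation k n X w ∈ L := fun w =>
    hL' _ ((D.coverRelation_exact X _).2 ⟨w, rfl⟩)
  have hker0 : ∀ w, s₀ ⟨coverRelation k n X w, hmem w⟩ = 0 := by
    intro w
    induction w using Finsupp.induction_linear with
    | zero =>
      have : (⟨coverRelation k n X 0, hmem _⟩ : L) = 0 := Subtype.ext (map_zero _)
      rw [this, map_zero]
    | add v w hv hw =>
      have : (⟨coverRelation k n X (v + w), hmem _⟩ : L) =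
        ⟨coverRelation k n X v, hmem v⟩ + ⟨coverRelation k n X w, hmem w⟩ :=
        Subtype.ext (map_add _ _ _)
      rw [this, map_add, hv, hw, add_zero]
    | single z p =>
      have : (⟨coverRelation k n X (Finsupp.single z p), hmem _⟩ : L) =
          p • ⟨coverRelation k n X (Finsupp.single z 1), hmem _⟩ := by
        apply Subtype.ext
        rw [Submodule.coe_smul, ← map_smul, Finsupp.smul_single, smul_eq_mul, mul_one]
      rw [this, hsmul, hs₀, Finset.sum_eq_zero, smul_zero]
      intro I _
      by_cases hI : I = ∅
      · rw [hI, D.e_empty, zero_smul]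
      · have : c I ⟨coverRelation k n X (Finsupp.single z 1), hmem _⟩ = 0 :=
          Subtype.ext (by rw [hc, coverPart_coverRelation_single X I z hI]; rfl)
        rw [this, map_zero, smul_zero]
  -- Vanishing on relations makes s₀ depend only on the image in the free Q-module, so any choice of
  -- lifts defines σ.
  have hker : ∀ v w : L, D.cover X v = D.cover X w → s₀ v = s₀ w := by
    intro v w h
    rw [← sub_eq_zero, ← map_sub]
    obtain ⟨u, hu⟩ := (D.coverRelation_exact X (v - w : L)).1 (by
      rw [Submodule.coe_sub, map_sub, h, sub_self])
    have : v - w = ⟨coverRelation k n X u, hmem u⟩ := Subtype.ext hu.symm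
    rw [this, hker0]
  choose l hlL hl using hjN
  have key : ∀ (v : L) (y : N), j y = (Restrict.of D.ψ _).symm (D.cover X v) →
      s₀ ⟨l y, hlL y⟩ = s₀ v := fun v y h =>
    hker _ _ ((Restrict.of D.ψ _).symm.injective ((hl y).symm.trans h))
  refine ⟨⟨⟨fun y => s₀ ⟨l y, hlL y⟩, fun y z => ?_⟩, fun q y => ?_⟩, fun v y h =>
    (key v y h).trans (hs₀ v)⟩
  · rw [← map_add]
    apply key
    rw [map_add, hl y, hl z, Submodule.coe_add, map_add, map_add]
  · choose p hp using fun K => D.exists_mul_e q K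
    -- The action of q is rebuilt from P-scalars and degree projections, both of which s₀ respects.
    have : s₀ (∑ K, p K • c K ⟨l y, hlL y⟩) = q • s₀ ⟨l y, hlL y⟩ := by
      conv_rhs => rw [D.eq_sum_mul_e q, Finset.sum_smul]
      rw [map_sum]
      refine Finset.sum_congr rfl fun K _ => ?_
      rw [hsmul, he, ← mul_smul, hp]
    rw [RingHom.id_apply, ← this]
    apply key
    conv_lhs => rw [map_smul, D.eq_sum_mul_e q, Finset.sum_smul]
    rw [Submodule.coe_sum, map_sum, map_sum]
    refine Finset.sum_congr rfl fun K _ => ?_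
    rw [Submodule.coe_smul, map_smul, hp, mul_smul, hl, hc, ← D.cover_coverPart]
    rfl

end Averaging

variable {X} [AddCommGroup X] [Module Q X]

/-- The kernel L of the composite P-cover of X is projective over P, so L → N lifts through the free
Q-cover of N, the kernel of the Q-cover of X. Averaging the lift splits that cover Q-linearly, so N
is projective. -/
theorem pdLE_one_of_restrict (h : PdLE (MvPolynomial (Fin n) k) (Restrict D.ψ X) 1) :
    PdLE Q X 1 := by
  let g := freeCover Q X
  let g' := (Restrict.map D.ψ g) ∘ₗ D.cover X
  have hg' : Function.Surjective g' :=
    (Restrict.map_surjective D.ψ freeCover_surjective).comp (D.cover_surjective X)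
  let L := LinearMap.ker g'
  have hLproj : Module.Projective (MvPolynomial (Fin n) k) L :=
    pdLE_zero_iff.1 ((pdLE_of_projective 0).ker hg' h)
  let N := LinearMap.ker g
  have hLN : ∀ v, v ∈ L ↔ (Restrict.of D.ψ _).symm (D.cover X v) ∈ N := fun v => Iff.rfl
  let π := freeCover Q N
  let θ : L →ₗ[MvPolynomial (Fin n) k] Restrict D.ψ N :=
    (Restrict.kerEquiv D.ψ g).toLinearMap ∘ₗ (((D.cover X) ∘ₗ L.subtype).codRestrict _
      fun v => v.2)
  have hθ : ∀ v : L, (((Restrict.of D.ψ _).symm (θ v) : N) : X →₀ Q) =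
      (Restrict.of D.ψ _).symm (D.cover X v) := fun v => rfl
  obtain ⟨s, hs⟩ := Module.projective_lifting_property (Restrict.map D.ψ π) θ
    (Restrict.map_surjective D.ψ freeCover_surjective)
  have hLpart : ∀ I, ∀ v ∈ L, coverPart k n X I v ∈ L := fun I v hv => by
    rw [hLN, D.cover_coverPart]
    exact N.smul_mem _ ((hLN v).1 hv)
  obtain ⟨σ, hσ⟩ := D.exists_average (N := N) L hLpart
    (fun v hv => by rw [hLN, hv, map_zero]; exact N.zero_mem) N.subtype
    (fun y => by
      obtain ⟨v, hv⟩ := D.cover_surjective X (Restrict.of D.ψ _ y.1)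
      have hv' : (Restrict.of D.ψ _).symm (D.cover X v) = y.1 := by rw [hv]; rfl
      exact ⟨v, (hLN v).2 (hv' ▸ y.2), hv'.symm⟩) s
  have hproj : Module.Projective Q N := by
    refine Module.Projective.of_split σ π (LinearMap.ext fun y => ?_)
    obtain ⟨v, hv⟩ := D.cover_surjective X (Restrict.of D.ψ _ y.1)
    have hv' : (Restrict.of D.ψ _).symm (D.cover X v) = y.1 := by rw [hv]; rfl
    have hvL : v ∈ L := (hLN v).2 (hv' ▸ y.2)
    rw [LinearMap.comp_apply, hσ ⟨v, hvL⟩ y hv'.symm, map_sum, LinearMap.id_apply]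
    have hπ : ∀ w : L, π ((Restrict.of D.ψ _).symm (s w)) = (Restrict.of D.ψ _).symm (θ w) :=
      fun w => congrArg (Restrict.of D.ψ _).symm (LinearMap.congr_fun hs w)
    apply Subtype.ext
    rw [Submodule.coe_sum]
    calc _ = ∑ I, D.e I • (y : X →₀ Q) := Finset.sum_congr rfl fun I _ => by
          rw [map_smul, hπ, Submodule.coe_smul, hθ, D.cover_coverPart, ← mul_smul, D.e_mul_e,
            if_pos rfl, hv']
      _ = y := by rw [← Finset.sum_smul, D.sum_e, one_smul]
  exact PdLE.of_ker freeCover_surjective (pdLE_of_projective 1) (pdLE_of_projective 0)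

/-- Induction on syzygies. Free Q-modules have dimension at most 1 over P, so the kernel of a free
cover still loses one dimension over P as long as the bound on it stays at least 1; hence the base
case m + 1 = 1. -/
theorem pdLE_of_restrict {m : ℕ} (h : PdLE (MvPolynomial (Fin n) k) (Restrict D.ψ X) (m + 1)) :
    PdLE Q X (m + 1) := by
  induction m generalizing X with
  | zero => exact D.pdLE_one_of_restrict h
  | succ m ih =>
    refine PdLE.of_ker freeCover_surjective (pdLE_of_projective _) (ih ?_)
    exact (PdLE.ker (Restrict.map_surjective D.ψ freeCover_surjective)
      ((D.pdLE_restrict_free X).mono (by omega)) h).of_equiv (Restrict.kerEquiv _ _)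

include D in
variable (X) in
/-- Every module over a cube ring of dimension `n ≥ 1` has projective dimension at most `n`. -/
theorem pdLE (hn : 1 ≤ n) : PdLE Q X n := by
  obtain ⟨m, rfl⟩ := Nat.exists_eq_add_of_le' hn
  exact D.pdLE_of_restrict (pdLE_mvPolynomial k (m + 1) _)

end CubeRing

end NormalCrossing

/-! ### Koszul modules over a cube ring -/

noncomputable section

namespace NormalCrossing

namespace CubeRing

open MvPolynomial

variable {k : Type u} [Field k] {n : ℕ} {Q : Type u} [Ring Q] (D : CubeRing k n Q)

/-- The left ideal of `Q` generated by `1 - e_K` and the variables in `T`. -/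
def koszulIdeal (K T : Finset (Fin n)) : Submodule Q Q :=
  Submodule.span Q (insert (1 - D.e K) ((fun i => D.ψ (X i)) '' T))

/-- The quotient of the projective module `Q e_K` by the variables in `T`. -/
abbrev KoszulModule (K T : Finset (Fin n)) : Type u := Q ⧸ D.koszulIdeal K T

variable {D}

theorem one_sub_e_mem (K T : Finset (Fin n)) : 1 - D.e K ∈ D.koszulIdeal K T :=
  Submodule.subset_span (Set.mem_insert _ _)

theorem ψ_X_mem {K T : Finset (Fin n)} {i : Fin n} (hi : i ∈ T) :
    D.ψ (X i) ∈ D.koszulIdeal K T :=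
  Submodule.subset_span (Set.mem_insert_of_mem _ ⟨i, hi, rfl⟩)

theorem mk_mul_e (K T : Finset (Fin n)) (q : Q) :
    (Submodule.Quotient.mk (q * D.e K) : D.KoszulModule K T) = Submodule.Quotient.mk q := by
  symm
  rw [Submodule.Quotient.eq]
  have := (D.koszulIdeal K T).smul_mem q (one_sub_e_mem K T)
  rwa [smul_eq_mul, mul_sub, mul_one] at this

/-- The ideal of polynomials annihilating the generator of a Koszul module. -/
def annIdeal (k : Type u) [Field k] (K T : Finset (Fin n)) : Ideal (MvPolynomial (Fin n) k) :=
  Ideal.span {squarefreeMonomial k K} ⊔ Ideal.span (X '' (T : Set (Fin n)))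

theorem mem_koszulIdeal_of_mem {K T : Finset (Fin n)} {q : Q} {p : MvPolynomial (Fin n) k}
    (hp : p ∈ annIdeal k K T) (h : q * D.e K = D.ψ p * D.e K) : q ∈ D.koszulIdeal K T := by
  rw [← Submodule.Quotient.mk_eq_zero, ← mk_mul_e, h]
  obtain ⟨a, ha, b, hb, rfl⟩ := Submodule.mem_sup.1 hp
  rw [map_add, add_mul, (D.ψ_mul_e_eq_zero a K).2 (Ideal.mem_span_singleton.1 ha), zero_add,
    mk_mul_e, Submodule.Quotient.mk_eq_zero]
  clear h hp
  induction hb using Submodule.span_induction with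
  | mem x hx =>
    obtain ⟨i, hi, rfl⟩ := hx
    exact ψ_X_mem hi
  | zero => simp
  | add x y _ _ hx hy =>
    rw [map_add]
    exact add_mem hx hy
  | smul a x _ hx =>
    rw [smul_eq_mul, map_mul]
    exact Submodule.smul_mem _ _ hx

/-- With `mem_koszulIdeal_of_mem`, this identifies the quotient with P modulo t_K and the variables
in T, so injectivity becomes a question about polynomials. -/
theorem exists_mem_annIdeal {K T : Finset (Fin n)} {q : Q} (hq : q ∈ D.koszulIdeal K T) :
    ∃ p ∈ annIdeal k K T, q * D.e K = D.ψ p * D.e K := by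
  induction hq using Submodule.span_induction with
  | mem x hx =>
    rcases hx with rfl | ⟨i, hi, rfl⟩
    · exact ⟨0, zero_mem _, by simp [sub_mul, D.e_mul_e]⟩
    · exact ⟨X i, Submodule.mem_sup_right (Ideal.subset_span ⟨i, hi, rfl⟩), rfl⟩
  | zero => exact ⟨0, zero_mem _, by simp⟩
  | add x y _ _ hx hy =>
    obtain ⟨p, hp, hp'⟩ := hx
    obtain ⟨p', hq, hq'⟩ := hy
    exact ⟨p + p', add_mem hp hq, by rw [add_mul, hp', hq', map_add, add_mul]⟩
  | smul b x _ hx =>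
    obtain ⟨p, hp, hp'⟩ := hx
    rw [smul_eq_mul, mul_assoc, hp']
    clear hp'
    obtain ⟨a, ha, c, hc, rfl⟩ := Submodule.mem_sup.1 hp
    rw [map_add, add_mul, (D.ψ_mul_e_eq_zero a K).2 (Ideal.mem_span_singleton.1 ha), zero_add]
    clear hp
    induction hc using Submodule.span_induction generalizing b with
    | mem x hx =>
      obtain ⟨i, hi, rfl⟩ := hx
      obtain ⟨r, hr⟩ := D.exists_mul_e b (K ∆ {i})
      refine ⟨r * X i, Ideal.mul_mem_left _ _
        (Submodule.mem_sup_right (Ideal.subset_span ⟨i, hi, rfl⟩)), ?_⟩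
      -- Carrying e_K across tᵢ turns it into e_{K ∆ {i}}; there b is replaced by a polynomial, and
      -- the idempotent is carried back.
      rw [D.X_mul_e, ← mul_assoc, hr, mul_assoc, ← D.X_mul_e, map_mul, mul_assoc]
    | zero => exact ⟨0, zero_mem _, by simp⟩
    | add x y _ _ hx hy =>
      obtain ⟨p, hp, hp'⟩ := hx b
      obtain ⟨p', hq, hq'⟩ := hy b
      exact ⟨p + p', add_mem hp hq, by rw [map_add, add_mul, mul_add, hp', hq', map_add, add_mul]⟩
    | smul c x _ hx =>
      obtain ⟨p, hp, hp'⟩ := hx (b * D.ψ c)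
      exact ⟨p, hp, by rw [smul_eq_mul, map_mul, mul_assoc, ← mul_assoc, hp']⟩

variable (D) in
/-- Right multiplication by the variable `t_j` between Koszul modules. -/
def koszulMap (K T : Finset (Fin n)) (j : Fin n) :
    D.KoszulModule (K ∆ {j}) T →ₗ[Q] D.KoszulModule K T :=
  Submodule.mapQ _ _ (LinearMap.toSpanSingleton Q Q (D.ψ (X j))) (by
    refine Submodule.span_le.2 ?_
    rintro _ (rfl | ⟨i, hi, rfl⟩)
    · simp only [Submodule.comap_coe, Set.mem_preimage, LinearMap.toSpanSingleton_apply,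
        smul_eq_mul, SetLike.mem_coe]
      rw [sub_mul, one_mul, ← D.X_mul_e]
      have := (D.koszulIdeal K T).smul_mem (D.ψ (X j)) (one_sub_e_mem K T)
      rwa [smul_eq_mul, mul_sub, mul_one] at this
    · simp only [Submodule.comap_coe, Set.mem_preimage, LinearMap.toSpanSingleton_apply,
        smul_eq_mul, SetLike.mem_coe]
      rw [← map_mul, mul_comm, map_mul]
      exact Submodule.smul_mem _ _ (ψ_X_mem hi))

@[simp]
theorem koszulMap_mk (K T : Finset (Fin n)) (j : Fin n) (q : Q) :
    D.koszulMap K T j (Submodule.Quotient.mk q) = Submodule.Quotient.mk (q * D.ψ (X j)) := rfl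

theorem koszulIdeal_insert (K T : Finset (Fin n)) (j : Fin n) :
    D.koszulIdeal K (insert j T) = D.koszulIdeal K T ⊔ Submodule.span Q {D.ψ (X j)} := by
  rw [koszulIdeal, koszulIdeal, ← Submodule.span_union, Finset.coe_insert, Set.image_insert_eq,
    Set.insert_comm, ← Set.union_singleton]

variable (D) in
/-- The projection between Koszul modules. -/
def koszulProj (K T : Finset (Fin n)) (j : Fin n) :
    D.KoszulModule K T →ₗ[Q] D.KoszulModule K (insert j T) :=
  Submodule.factor (by rw [koszulIdeal_insert]; exact le_sup_left)

@[simp]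
theorem koszulProj_mk (K T : Finset (Fin n)) (j : Fin n) (q : Q) :
    D.koszulProj K T j (Submodule.Quotient.mk q) = Submodule.Quotient.mk q := rfl

theorem koszulProj_surjective (K T : Finset (Fin n)) (j : Fin n) :
    Function.Surjective (D.koszulProj K T j) :=
  Submodule.factor_surjective (by rw [koszulIdeal_insert]; exact le_sup_left)

theorem koszul_exact (K T : Finset (Fin n)) (j : Fin n) :
    Function.Exact (D.koszulMap K T j) (D.koszulProj K T j) := by
  intro x
  obtain ⟨q, rfl⟩ := Submodule.Quotient.mk_surjective _ x
  rw [koszulProj_mk, Submodule.Quotient.mk_eq_zero, koszulIdeal_insert]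
  constructor
  · intro h
    obtain ⟨a, ha, b, hb, rfl⟩ := Submodule.mem_sup.1 h
    obtain ⟨c, rfl⟩ := Submodule.mem_span_singleton.1 hb
    refine ⟨Submodule.Quotient.mk c, ?_⟩
    rw [koszulMap_mk, Submodule.Quotient.mk_add, (Submodule.Quotient.mk_eq_zero _).2 ha, zero_add,
      smul_eq_mul]
  · rintro ⟨y, hy⟩
    obtain ⟨c, rfl⟩ := Submodule.Quotient.mk_surjective _ y
    rw [koszulMap_mk, eq_comm, Submodule.Quotient.eq] at hy
    rw [← sub_add_cancel q (c * D.ψ (X j))]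
    exact add_mem (Submodule.mem_sup_left hy)
      (Submodule.mem_sup_right (Submodule.mem_span_singleton.2 ⟨c, rfl⟩))

/-- Right multiplication by t_j becomes multiplication on these polynomial quotients; the hypothesis
bounds the relevant colon ideal. -/
theorem koszulMap_injective {K T : Finset (Fin n)} {j : Fin n}
    (h : ∀ p : MvPolynomial (Fin n) k, p * X j ∈ annIdeal k K T → p ∈ annIdeal k (K ∆ {j}) T) :
    Function.Injective (D.koszulMap K T j) := by
  rw [injective_iff_map_eq_zero]
  intro x hx
  obtain ⟨q, rfl⟩ := Submodule.Quotient.mk_surjective _ x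
  rw [koszulMap_mk, Submodule.Quotient.mk_eq_zero] at hx
  obtain ⟨p, hp, hp'⟩ := exists_mem_annIdeal hx
  obtain ⟨r, hr⟩ := D.exists_mul_e q (K ∆ {j})
  rw [mul_assoc, D.X_mul_e, ← mul_assoc, hr, mul_assoc, ← D.X_mul_e, ← mul_assoc, ← map_mul,
    ← sub_eq_zero, ← sub_mul, ← map_sub, D.ψ_mul_e_eq_zero] at hp'
  rw [Submodule.Quotient.mk_eq_zero]
  refine mem_koszulIdeal_of_mem (h r ?_) hr
  rw [← sub_add_cancel (r * X j) p]
  exact add_mem (Submodule.mem_sup_left (Ideal.mem_span_singleton.2 hp')) hp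

theorem annIdeal_eq_of_mem {K T : Finset (Fin n)} {i : Fin n} (hK : i ∈ K) (hT : i ∈ T) :
    annIdeal k K T = Ideal.span (X '' (T : Set (Fin n))) := by
  refine sup_eq_right.2 ((Ideal.span_singleton_le_iff_mem _).2 ?_)
  rw [squarefreeMonomial, ← Finset.mul_prod_erase _ _ hK]
  exact Ideal.mul_mem_right _ _ (Ideal.subset_span ⟨i, hT, rfl⟩)

/-- Once K and T meet, t_K is redundant modulo the variables in T, and t_j with j ∉ T is a
nonzerodivisor modulo them. -/
theorem koszulMap_injective_of_mem {K T : Finset (Fin n)} {i j : Fin n} (hK : i ∈ K) (hT : i ∈ T)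
    (hj : j ∉ T) : Function.Injective (D.koszulMap K T j) := by
  refine koszulMap_injective fun p hp => ?_
  have hij : i ≠ j := fun h => hj (h ▸ hT)
  rw [annIdeal_eq_of_mem (by simp [Finset.mem_symmDiff, hK, hij]) hT, mem_ideal_span_X_image]
  rw [annIdeal_eq_of_mem hK hT, mem_ideal_span_X_image] at hp
  intro m hm
  obtain ⟨l, hl, hl'⟩ := hp (m + Finsupp.single j 1) (by
    rw [mem_support_iff, coeff_mul_X]; exact mem_support_iff.1 hm)
  refine ⟨l, hl, ?_⟩
  have : j ≠ l := fun h => hj (h ▸ hl)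
  simpa [Finsupp.single_eq_of_ne this.symm] using hl'

/-- For j ∈ K, cancelling t_j from t_K ∣ p t_j leaves divisibility of p by the monomial of K without
j. -/
theorem koszulMap_injective_of_empty {K : Finset (Fin n)} {j : Fin n} (hK : j ∈ K) :
    Function.Injective (D.koszulMap K ∅ j) := by
  refine koszulMap_injective fun p hp => ?_
  have hKj : K ∆ {j} = K.erase j := by
    ext l
    by_cases h : l = j <;> simp [Finset.mem_symmDiff, h, hK]
  simp only [annIdeal, Finset.coe_empty, Set.image_empty, Ideal.span_empty, sup_bot_eq,
    Ideal.mem_span_singleton] at hp ⊢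
  rw [squarefreeMonomial, ← Finset.prod_erase_mul _ _ hK] at hp
  rw [hKj]
  exact (mul_dvd_mul_iff_right (X_ne_zero j)).1 hp

variable (D) in
/-- The projective module `Q e_K` embeds into `Q`. -/
def koszulIncl (K : Finset (Fin n)) : D.KoszulModule K ∅ →ₗ[Q] Q :=
  Submodule.liftQ _ (LinearMap.toSpanSingleton Q Q (D.e K)) (by
    refine Submodule.span_le.2 ?_
    rintro _ (rfl | ⟨i, hi, rfl⟩)
    · simp [sub_mul, D.e_mul_e]
    · simp at hi)

@[simp]
theorem koszulIncl_mk (K : Finset (Fin n)) (q : Q) :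
    D.koszulIncl K (Submodule.Quotient.mk q) = q * D.e K := rfl

theorem mk_koszulIncl (K : Finset (Fin n)) (x : D.KoszulModule K ∅) :
    Submodule.Quotient.mk (D.koszulIncl K x) = x := by
  obtain ⟨q, rfl⟩ := Submodule.Quotient.mk_surjective _ x
  rw [koszulIncl_mk, mk_mul_e]

instance koszulModule_projective (K : Finset (Fin n)) :
    Module.Projective Q (D.KoszulModule K ∅) :=
  Module.Projective.of_split (D.koszulIncl K) (Submodule.mkQ _)
    (LinearMap.ext fun x => mk_koszulIncl K x)

end CubeRing

end NormalCrossing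

end

/-! ### Modules over a corner ring -/

noncomputable section

namespace NormalCrossing

section Corner

variable {B Q : Type u} [Ring B] [Ring Q] (ι : B →ₙ+* Q)
variable (X : Type u) {Y Z : Type u} [AddCommGroup X] [Module Q X] [AddCommGroup Y] [Module Q Y]
  [AddCommGroup Z] [Module Q Z]

/-- For a nonunital ring homomorphism `ι : B → Q` and a `Q`-module `X`, the subgroup `ι(1) X`. -/
def corner : AddSubgroup X where
  carrier := {x | ι 1 • x = x}
  add_mem' {x y} hx hy := by
    simp only [Set.mem_ofPred_eq] at *
    rw [smul_add, hx, hy]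
  zero_mem' := smul_zero _
  neg_mem' {x} hx := by
    simp only [Set.mem_ofPred_eq] at *
    rw [smul_neg, hx]

variable {X}

theorem mem_corner {x : X} : x ∈ corner ι X ↔ ι 1 • x = x := Iff.rfl

theorem smul_mem_corner (b : B) (x : X) : ι b • x ∈ corner ι X := by
  rw [mem_corner, ← mul_smul, ← map_mul, one_mul]

instance : Module B (corner ι X) where
  smul b x := ⟨ι b • x.1, smul_mem_corner ι b x.1⟩
  one_smul x := Subtype.ext x.2
  mul_smul a b x := Subtype.ext (by
    change ι (a * b) • (x : X) = ι a • ι b • (x : X)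
    rw [map_mul, mul_smul])
  smul_zero a := Subtype.ext (smul_zero (ι a))
  smul_add a x y := Subtype.ext (smul_add (ι a) (x : X) y)
  add_smul a b x := Subtype.ext (by
    change ι (a + b) • (x : X) = ι a • (x : X) + ι b • (x : X)
    rw [map_add, add_smul])
  zero_smul x := Subtype.ext (by
    change ι 0 • (x : X) = 0
    rw [map_zero, zero_smul])

@[simp]
theorem coe_smul_corner (b : B) (x : corner ι X) : ((b • x : corner ι X) : X) = ι b • (x : X) :=
  rfl

/-- The functoriality of `corner`. -/
def cornerMap (f : X →ₗ[Q] Y) : corner ι X →ₗ[B] corner ι Y where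
  toFun x := ⟨f x, by rw [mem_corner, ← map_smul, x.2]⟩
  map_add' x y := Subtype.ext (map_add f _ _)
  map_smul' b x := Subtype.ext (map_smul f _ _)

@[simp]
theorem coe_cornerMap (f : X →ₗ[Q] Y) (x : corner ι X) : (cornerMap ι f x : Y) = f x := rfl

theorem cornerMap_injective {f : X →ₗ[Q] Y} (hf : Function.Injective f) :
    Function.Injective (cornerMap ι f) := fun _ _ h =>
  Subtype.ext (hf (congrArg Subtype.val h))

theorem cornerMap_surjective {f : X →ₗ[Q] Y} (hf : Function.Surjective f) :
    Function.Surjective (cornerMap ι f) := by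
  intro y
  obtain ⟨x, hx⟩ := hf y
  exact ⟨⟨ι 1 • x, smul_mem_corner ι 1 x⟩, Subtype.ext (by
    rw [coe_cornerMap, map_smul, hx, y.2])⟩

theorem cornerMap_exact {f : X →ₗ[Q] Y} {g : Y →ₗ[Q] Z} (h : Function.Exact f g) :
    Function.Exact (cornerMap ι f) (cornerMap ι g) := by
  intro y
  constructor
  · intro hy
    obtain ⟨x, hx⟩ := (h y).1 (congrArg Subtype.val hy)
    exact ⟨⟨ι 1 • x, smul_mem_corner ι 1 x⟩, Subtype.ext (by
      rw [coe_cornerMap, map_smul, hx, y.2])⟩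
  · rintro ⟨x, rfl⟩
    exact Subtype.ext (h.apply_apply_eq_zero _)

theorem PdLE.corner_of_retract {n : ℕ} (h : PdLE B (corner ι X) n) (i : Y →ₗ[Q] X)
    (r : X →ₗ[Q] Y) (hri : r ∘ₗ i = LinearMap.id) : PdLE B (corner ι Y) n :=
  h.of_retract (cornerMap ι i) (cornerMap ι r)
    (LinearMap.ext fun y => Subtype.ext (LinearMap.congr_fun hri y))

theorem PdLE.corner_dfinsupp {τ : Type u} {X : τ → Type u} [∀ i, AddCommGroup (X i)]
    [∀ i, Module Q (X i)] {n : ℕ} (h : ∀ i, PdLE B (corner ι (X i)) n) :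
    PdLE B (corner ι (Π₀ i, X i)) n := by
  refine (PdLE.dfinsupp h).of_retract
    { toFun := fun v => DFinsupp.mapRange (fun i x => (⟨ι 1 • x, smul_mem_corner ι 1 x⟩ :
        corner ι (X i))) (fun i => Subtype.ext (smul_zero _)) (v : Π₀ i, X i)
      map_add' := fun v w => by
        ext i
        simp [smul_add]
      map_smul' := fun b v => by
        ext i
        simp [← mul_smul, ← map_mul] }
    { toFun := fun v => ⟨DFinsupp.mapRange (fun i (x : corner ι (X i)) => (x : X i))
        (fun i => rfl) v, by
          rw [mem_corner]
          ext i
          rw [DFinsupp.smul_apply, DFinsupp.mapRange_apply]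
          exact (v i).2⟩
      map_add' := fun v w => by
        ext i
        simp
      map_smul' := fun b v => by
        ext i
        simp } ?_
  ext v i
  have hv := DFunLike.congr_fun v.2 i
  simpa using hv

variable {ι}

section Coinduced

variable (hinj : Function.Injective ι) (hfull : ∀ q, ∃ b, ι b = ι 1 * q * ι 1)
variable (ι) (M : Type u) [AddCommGroup M] [Module B M]

/-- The `Q`-module coinduced from a `B`-module. -/
def Coinduced : Type u := corner ι Q →ₗ[B] M

instance : AddCommGroup (Coinduced ι M) := inferInstanceAs (AddCommGroup (corner ι Q →ₗ[B] M))

/-- Right multiplication on `ι(1) Q`. -/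
def cornerMulRight (q : Q) : corner ι Q →ₗ[B] corner ι Q :=
  cornerMap ι (LinearMap.toSpanSingleton Q Q q)

@[simp]
theorem coe_cornerMulRight (q : Q) (x : corner ι Q) :
    (cornerMulRight ι q x : Q) = (x : Q) * q := rfl

variable {ι M} in
/-- The linear map underlying an element of the coinduced module. -/
def Coinduced.eval (f : Coinduced ι M) : corner ι Q →ₗ[B] M := f

instance : Module Q (Coinduced ι M) where
  smul q f := f.eval ∘ₗ cornerMulRight ι q
  one_smul f := LinearMap.ext fun x => congrArg f.eval (Subtype.ext (mul_one x.1))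
  mul_smul a b f := LinearMap.ext fun x => congrArg f.eval
    (Subtype.ext (mul_assoc x.1 a b).symm)
  smul_zero _ := LinearMap.ext fun _ => rfl
  smul_add _ _ _ := LinearMap.ext fun _ => rfl
  add_smul a b f := LinearMap.ext fun x => (congrArg f.eval
    (Subtype.ext (mul_add x.1 a b) :
      cornerMulRight ι (a + b) x = cornerMulRight ι a x + cornerMulRight ι b x)).trans
      (map_add f.eval _ _)
  zero_smul f := LinearMap.ext fun x => (congrArg f.eval
    (Subtype.ext (mul_zero x.1) : cornerMulRight ι 0 x = 0)).trans (map_zero f.eval)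

include hinj hfull in
-- With ε = ι(1), M is a retract of ε Hom_B(εQ, M): m goes to x ↦ ι⁻¹(εxε) m, and evaluation at ε is
-- a left inverse.
theorem PdLE.of_corner_coinduced {n : ℕ} (h : PdLE B (corner ι (Coinduced ι M)) n) :
    PdLE B M n := by
  have h1 : ι 1 * ι 1 = ι 1 := by rw [← map_mul, one_mul]
  let ε : corner ι Q := ⟨ι 1, h1⟩
  choose c hc using hfull
  have hcι : ∀ b, c (ι b) = b := fun b => hinj (by
    rw [hc, ← map_mul, ← map_mul, one_mul, mul_one])
  have hcadd : ∀ x y, c (x + y) = c x + c y := fun x y => hinj (by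
    rw [map_add, hc, hc, hc, mul_add, add_mul])
  have hcmul : ∀ b x, c (ι b * x) = b * c x := fun b x => hinj (by
    rw [map_mul, hc, hc, ← mul_assoc, ← mul_assoc, ← mul_assoc, ← map_mul, ← map_mul, one_mul,
      mul_one])
  have hcone : ∀ x, c (x * ι 1) = c x := fun x => hinj (by
    rw [hc, hc, mul_assoc, mul_assoc, h1, mul_assoc])
  have hcι' : ∀ x b, c (x * ι b) = c x * b := fun x b => hinj (by
    rw [map_mul, hc, hc, mul_assoc, mul_assoc, mul_assoc, mul_assoc, ← map_mul, ← map_mul, one_mul,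
      mul_one])
  let φ : M → Coinduced ι M := fun m => ({
    toFun := fun x => c (x : Q) • m
    map_add' := fun x y => by rw [AddSubgroup.coe_add, hcadd, add_smul]
    map_smul' := fun b x => by
      rw [coe_smul_corner, smul_eq_mul, hcmul, mul_smul, RingHom.id_apply] } :
      corner ι Q →ₗ[B] M)
  refine h.of_retract
    { toFun := fun m => ⟨φ m, LinearMap.ext fun x => ?_⟩
      map_add' := fun m m' => Subtype.ext (LinearMap.ext fun x => smul_add _ _ _)
      map_smul' := fun b m => Subtype.ext (LinearMap.ext fun x => ?_) }
    { toFun := fun f => f.1.eval ε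
      map_add' := fun f g => ?_
      map_smul' := fun b f => ?_ } ?_
  · change c (x.1 * ι 1) • m = c x.1 • m
    rw [hcone]
  · change c x.1 • b • m = c (x.1 * ι b) • m
    rw [hcι', mul_smul]
  · rfl
  · change f.1.eval (cornerMulRight ι (ι b) ε) = b • f.1.eval ε
    rw [← map_smul]
    refine congrArg f.1.eval (Subtype.ext ?_)
    change ι 1 * ι b = ι b * ι 1
    rw [← map_mul, ← map_mul, one_mul, mul_one]
  · ext m
    change c (ι 1) • m = m
    rw [hcι, one_smul]

end Coinduced

end Corner

/-! ### Omitting one vertex of a cube ring -/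

namespace CubeRing

open MvPolynomial

variable {k : Type u} [Field k] {n : ℕ} {B Q : Type u} [Ring B] [Ring Q] {D : CubeRing k n Q}
variable {ι : B →ₙ+* Q} {K : Finset (Fin n)}

theorem koszul_flip {J T : Finset (Fin n)} {i j : Fin n} (hJ : i ∈ J) (hT : i ∈ T) (hj : j ∉ T) :
    i ∈ J ∆ {j} := by
  have : i ≠ j := fun h => hj (h ▸ hT)
  simp [Finset.mem_symmDiff, hJ, this]

section

variable (hinj : Function.Injective ι) (hfull : ∀ q, ∃ b, ι b = ι 1 * q * ι 1)
  (hι : ι 1 = 1 - D.e K)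

include hinj hfull hι

/-- For J ≠ K one has e_J ε = e_J, so εQ e_J lies inside εQε = B and is a direct summand of it. -/
theorem corner_koszul_projective {J : Finset (Fin n)} (hJ : J ≠ K) :
    Module.Projective B (corner ι (D.KoszulModule J ∅)) := by
  have h1 : ι 1 * ι 1 = ι 1 := by rw [← map_mul, one_mul]
  have hmem : ∀ x : corner ι (D.KoszulModule J ∅), ∃ b, ι b = D.koszulIncl J x := by
    intro x
    obtain ⟨b, hb⟩ := hfull (D.koszulIncl J x)
    refine ⟨b, hb.trans ?_⟩
    have h2 : ι 1 * D.koszulIncl J x = D.koszulIncl J x := by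
      rw [← smul_eq_mul, ← map_smul, x.2]
    rw [h2]
    obtain ⟨q, hq⟩ := Submodule.Quotient.mk_surjective _ (x : D.KoszulModule J ∅)
    rw [← hq, koszulIncl_mk, hι, mul_sub, mul_one, mul_assoc, D.e_mul_e, if_neg hJ, mul_zero,
      sub_zero]
  choose c hc using hmem
  refine Module.Projective.of_split
    { toFun := c
      map_add' := fun x y => hinj (by rw [map_add, hc, hc, hc, AddSubgroup.coe_add, map_add])
      map_smul' := fun b x => hinj (by
        rw [hc, coe_smul_corner, map_smul, smul_eq_mul, RingHom.id_apply, smul_eq_mul, map_mul,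
          hc]) }
    (LinearMap.toSpanSingleton B (corner ι (D.KoszulModule J ∅))
      ⟨Submodule.Quotient.mk (ι 1), by
        rw [mem_corner, ← Submodule.Quotient.mk_smul, smul_eq_mul, h1]⟩) ?_
  ext x
  change ι (c x) • Submodule.Quotient.mk (ι 1) = (x : D.KoszulModule J ∅)
  rw [← Submodule.Quotient.mk_smul, smul_eq_mul, ← map_mul, mul_one, hc, mk_koszulIncl]

/-- Iterating the Koszul sequences involves only the vertices J ∆ U with U ⊆ T ∪ {i}. The index j
outside T ∪ {i} keeps all of them different from K, so their corners are projective; killing tᵢ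
first, with i ∈ J, makes every map injective. -/
theorem pdLE_corner_koszul_of_differ {i : Fin n} (T : Finset (Fin n)) (hiT : i ∉ T)
    (J : Finset (Fin n)) (hi : i ∈ J) (hJ : ∃ j ∉ insert i T, j ∈ J ∆ K) :
    PdLE B (corner ι (D.KoszulModule J (insert i T))) (insert i T).card := by
  induction T using Finset.induction_on generalizing J with
  | empty =>
    obtain ⟨j, hj, hjJ⟩ := hJ
    have hji : j ≠ i := by simpa using hj
    have h1 := corner_koszul_projective hinj hfull hι (J := J) (by
      rintro rfl; simp at hjJ)
    have h2 := corner_koszul_projective hinj hfull hι (J := J ∆ {i}) (by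
      rintro rfl
      rw [← symmDiff_assoc, symmDiff_self] at hjJ
      simp [Finset.mem_symmDiff, hji] at hjJ)
    rw [Finset.card_insert_of_notMem hiT, Finset.card_empty]
    exact (pdLE_zero_iff.2 h2).right (cornerMap_injective ι (koszulMap_injective_of_empty hi))
      (cornerMap_exact ι (koszul_exact J ∅ i)) (cornerMap_surjective ι (koszulProj_surjective J ∅ i))
      (pdLE_of_projective _)
  | insert l T hl ih =>
    obtain ⟨j, hj, hjJ⟩ := hJ
    have hil : i ≠ l := fun h => hiT (by simp [h])
    have hiT' : i ∉ T := fun h => hiT (by simp [h])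
    have hlT : l ∉ insert i T := by simp [hil.symm, hl]
    have hj' : j ∉ insert i T := fun h => hj (by
      rw [Finset.insert_comm]; exact Finset.mem_insert_of_mem h)
    have hjl : j ≠ l := fun h => hj (by simp [h])
    rw [Finset.insert_comm, Finset.card_insert_of_notMem hlT]
    refine (ih hiT' (J ∆ {l}) (koszul_flip hi (Finset.mem_insert_self i T) hlT) ⟨j, hj', ?_⟩).right
      (cornerMap_injective ι
        (koszulMap_injective_of_mem hi (Finset.mem_insert_self i T) hlT))
      (cornerMap_exact ι (koszul_exact J _ l)) (cornerMap_surjective ι (koszulProj_surjective J _ l))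
      ((ih hiT' J hi ⟨j, hj', hjJ⟩).mono (Nat.le_succ _))
    rw [symmDiff_right_comm, Finset.mem_symmDiff]
    exact Or.inl ⟨hjJ, by simpa using hjl⟩

omit hinj hfull in
-- Modulo all variables only scalar multiples of the generator at vertex K survive, and ε = 1 - e_K
-- annihilates these.
theorem corner_koszul_univ_subsingleton :
    Subsingleton (corner ι (D.KoszulModule K Finset.univ)) := by
  refine ⟨fun x y => ?_⟩
  suffices h : ∀ x : corner ι (D.KoszulModule K Finset.univ), x = 0 by rw [h x, h y]
  intro x
  obtain ⟨q, hq⟩ := Submodule.Quotient.mk_surjective _ (x : D.KoszulModule K Finset.univ)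
  obtain ⟨p, hp⟩ := D.exists_mul_e q K
  have hp' : p - C (coeff 0 p) ∈ annIdeal k K Finset.univ := by
    refine Submodule.mem_sup_right ?_
    rw [mem_ideal_span_X_image]
    intro m hm
    by_contra! hm'
    have : m = 0 := by ext i; simpa using hm' i (by simp)
    rw [mem_support_iff, this] at hm
    simp at hm
  have h : (Submodule.Quotient.mk q : D.KoszulModule K Finset.univ) =
      Submodule.Quotient.mk (D.ψ (C (coeff 0 p)) * D.e K) := by
    rw [mk_mul_e, Submodule.Quotient.eq]
    exact mem_koszulIdeal_of_mem hp' (by rw [sub_mul, hp, ← sub_mul, ← map_sub])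
  apply Subtype.ext
  rw [← x.2, ← hq, h, ← Submodule.Quotient.mk_smul, smul_eq_mul, D.C_mul_e, ← mul_assoc, hι,
    sub_mul, one_mul, D.e_mul_e, if_pos rfl, sub_self, zero_mul]
  rfl

/-- Descending induction on T from [n], where the corner vanishes. For j ∉ T, the submodule at
vertex K ∆ {j} differs from K at j, so its corner has dimension at most |T| ≤ n - 1. -/
theorem pdLE_corner_koszul_self {i : Fin n} (hi : i ∈ K) (T : Finset (Fin n)) (hiT : i ∈ T) :
    PdLE B (corner ι (D.KoszulModule K T)) (n - 1) := by
  have hn : 1 ≤ n := Nat.one_le_iff_ne_zero.2 fun h => by subst h; exact i.elim0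
  induction hc : n - T.card using Nat.strong_induction_on generalizing T with
  | _ c ih =>
    by_cases hT : T = Finset.univ
    · subst hT
      have := corner_koszul_univ_subsingleton (B := B) hι
      exact pdLE_of_subsingleton _
    · obtain ⟨j, hj⟩ : ∃ j, j ∉ T := by
        by_contra! h
        exact hT (Finset.eq_univ_iff_forall.2 h)
      have hcard : T.card ≤ n - 1 := by
        have := Finset.card_lt_univ_of_notMem hj
        rw [Fintype.card_fin] at this
        omega
      have h1 : PdLE B (corner ι (D.KoszulModule (K ∆ {j}) T)) (n - 1) := by
        have := pdLE_corner_koszul_of_differ hinj hfull hι (T.erase i)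
          (Finset.notMem_erase i T) (K ∆ {j}) (koszul_flip hi hiT hj) ⟨j, by
            rw [Finset.insert_erase hiT]; exact hj, by
            rw [symmDiff_symmDiff_self']; simp⟩
        rw [Finset.insert_erase hiT] at this
        exact this.mono hcard
      refine h1.middle (cornerMap_injective ι (koszulMap_injective_of_mem hi hiT hj))
        (cornerMap_exact ι (koszul_exact K T j)) (cornerMap_surjective ι (koszulProj_surjective K T j))
        (ih _ ?_ _ (Finset.mem_insert_of_mem hiT) rfl)
      rw [Finset.card_insert_of_notMem hj]
      omega

/-- Only J = K needs work: for i ∈ K, εQ e_K is an extension of a module of dimension at most n - 1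
by the projective at K ∆ {i}. If K = ∅ the module is zero. -/
theorem pdLE_corner_koszul_empty (J : Finset (Fin n)) :
    PdLE B (corner ι (D.KoszulModule J ∅)) (n - 1) := by
  by_cases hJ : J = K
  · subst hJ
    rcases J.eq_empty_or_nonempty with rfl | ⟨i, hi⟩
    · have : Subsingleton (D.KoszulModule ∅ ∅) := by
        rw [Submodule.Quotient.subsingleton_iff, Submodule.eq_top_iff']
        intro q
        exact mem_koszulIdeal_of_mem (p := 0) (zero_mem _) (by simp [D.e_empty])
      exact pdLE_of_subsingleton _
    · have h1 := corner_koszul_projective hinj hfull hι (J := J ∆ {i}) (by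
        intro h
        have := symmDiff_eq_left.1 h
        simp at this)
      exact (pdLE_of_projective _).middle (cornerMap_injective ι (koszulMap_injective_of_empty hi))
        (cornerMap_exact ι (koszul_exact J ∅ i))
        (cornerMap_surjective ι (koszulProj_surjective J ∅ i))
        (pdLE_corner_koszul_self hinj hfull hι hi _ (by simp))
  · have := corner_koszul_projective hinj hfull hι hJ
    exact pdLE_of_projective _

end

section

variable (D) (X : Type u) [AddCommGroup X] [Module Q X]

/-- A cover of a `Q`-module by the indecomposable projectives `Q e_J`. -/
def KoszulCover : Type u := Π₀ z : X × Finset (Fin n), D.KoszulModule z.2 ∅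

instance : AddCommGroup (D.KoszulCover X) :=
  inferInstanceAs (AddCommGroup (Π₀ z : X × Finset (Fin n), D.KoszulModule z.2 ∅))

instance : Module Q (D.KoszulCover X) :=
  inferInstanceAs (Module Q (Π₀ z : X × Finset (Fin n), D.KoszulModule z.2 ∅))

instance : Module.Projective Q (D.KoszulCover X) :=
  inferInstanceAs (Module.Projective Q (Π₀ z : X × Finset (Fin n), D.KoszulModule z.2 ∅))

/-- The covering map of `KoszulCover`. -/
def koszulCover : D.KoszulCover X →ₗ[Q] X := by
  classical
  exact (DFinsupp.lsum ℕ fun z => (LinearMap.toSpanSingleton Q X z.1) ∘ₗ D.koszulIncl z.2 :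
    (Π₀ z : X × Finset (Fin n), D.KoszulModule z.2 ∅) →ₗ[Q] X)

theorem koszulCover_surjective : Function.Surjective (D.koszulCover X) := by
  classical
  intro x
  refine ⟨(∑ J, DFinsupp.single (x, J) (Submodule.Quotient.mk 1) :
    Π₀ z : X × Finset (Fin n), D.KoszulModule z.2 ∅), ?_⟩
  refine (map_sum (DFinsupp.lsum ℕ fun z : X × Finset (Fin n) =>
    (LinearMap.toSpanSingleton Q X z.1) ∘ₗ D.koszulIncl z.2) _ _).trans ?_
  simp [← Finset.sum_smul, D.sum_e]

variable {D X} (hinj : Function.Injective ι) (hfull : ∀ q, ∃ b, ι b = ι 1 * q * ι 1)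
  (hι : ι 1 = 1 - D.e K)

include hinj hfull hι

omit [AddCommGroup X] [Module Q X] in
variable (X) in
theorem pdLE_corner_koszulCover : PdLE B (corner ι (D.KoszulCover X)) (n - 1) :=
  PdLE.corner_dfinsupp (X := fun z : X × Finset (Fin n) => D.KoszulModule z.2 ∅) ι fun z =>
    pdLE_corner_koszul_empty hinj hfull hι z.2

/-- Taking corners is exact, so a resolution by sums of Q e_J becomes one by modules of dimension at
most n - 1 over B. -/
theorem pdLE_corner {m : ℕ} (h : PdLE Q X m) : PdLE B (corner ι X) (m + (n - 1)) := by
  induction m generalizing X with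
  | zero =>
    have := pdLE_zero_iff.1 h
    obtain ⟨s, hs⟩ := (D.koszulCover X).exists_rightInverse_of_surjective
      (LinearMap.range_eq_top.2 (D.koszulCover_surjective X))
    rw [zero_add]
    exact (pdLE_corner_koszulCover X hinj hfull hι).corner_of_retract ι s _ hs
  | succ m ih =>
    have h1 := ih (PdLE.ker (Y := D.KoszulCover X) (D.koszulCover_surjective X)
      (pdLE_of_projective m) h)
    rw [Nat.add_right_comm]
    exact h1.right (cornerMap_injective ι (LinearMap.ker (D.koszulCover X)).injective_subtype)
      (cornerMap_exact ι (LinearMap.exact_subtype_ker_map _))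
      (cornerMap_surjective ι (D.koszulCover_surjective X))
      ((pdLE_corner_koszulCover X hinj hfull hι).mono (by omega))

/-- Omitting one idempotent from a cube ring yields a ring of global dimension at most `2n - 1`. -/
theorem pdLE_of_omit (hn : 1 ≤ n) (M : Type u) [AddCommGroup M] [Module B M] :
    PdLE B M (2 * n - 1) := by
  have := pdLE_corner hinj hfull hι (D.pdLE (Coinduced ι M) hn)
  rw [show n + (n - 1) = 2 * n - 1 by omega] at this
  exact this.of_corner_coinduced ι hinj hfull M

end

end CubeRing

end NormalCrossing

end

/-! ### Nonvanishing Ext groups and characters -/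

noncomputable section

namespace NormalCrossing

section Ext

open CategoryTheory Abelian

universe w v w'

variable {C : Type v} [Category.{w} C] [Abelian C] [HasExt.{w'} C] {S : ShortComplex C} {Z : C}

theorem ext_eq_zero_of_shortExact (hS : S.ShortExact) (h1 : ∀ m, ∀ x : Ext S.X₁ Z m, x = 0)
    (h2 : ∀ m, ∀ x : Ext S.X₂ Z m, x = 0) (m : ℕ) (x : Ext S.X₃ Z m) : x = 0 := by
  have hx := h2 m ((Ext.mk₀ S.g).comp x (zero_add m))
  cases m with
  | zero =>
    obtain ⟨f, rfl⟩ := (Ext.mk₀_bijective _ _).2 x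
    rw [Ext.mk₀_comp_mk₀, Ext.mk₀_eq_zero_iff] at hx
    have := hS.epi_g
    rw [Ext.mk₀_eq_zero_iff]
    exact (cancel_epi S.g).1 (by rw [hx, Limits.comp_zero])
  | succ m =>
    obtain ⟨y, rfl⟩ := Ext.contravariant_sequence_exact₃ hS _ x hx (add_comm 1 m)
    rw [h1 m y, Ext.comp_zero]

/-- The connecting map out of Extᵐ(X₁, Z) is injective when Extᵐ(X₂, Z) vanishes. -/
theorem exists_ext_ne_zero_of_shortExact (hS : S.ShortExact) {m : ℕ}
    (h1 : ∃ x : Ext S.X₁ Z m, x ≠ 0) (h2 : ∀ x : Ext S.X₂ Z m, x = 0) :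
    ∃ x : Ext S.X₃ Z (m + 1), x ≠ 0 := by
  obtain ⟨x, hx⟩ := h1
  refine ⟨hS.extClass.comp x (add_comm 1 m), fun h0 => hx ?_⟩
  obtain ⟨y, rfl⟩ := Ext.contravariant_sequence_exact₁ hS _ x (add_comm 1 m) h0
  rw [h2 y, Ext.comp_zero]

end Ext

namespace CubeRing

open MvPolynomial CategoryTheory Abelian

variable {k : Type u} [Field k] {n : ℕ} {Q : Type u} [Ring Q] (D : CubeRing k n Q)
variable (Z : Type u) [AddCommGroup Z] [Module Q Z]

/-- The short complex `S(K ∆ {j}, T) → S(K, T) → S(K, T ∪ {j})` of Koszul modules. -/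
def koszulComplex (K T : Finset (Fin n)) (j : Fin n) : ShortComplex (ModuleCat.{u} Q) :=
  ModuleCat.shortComplexOfCompEqZero (D.koszulMap K T j) (D.koszulProj K T j)
    (koszul_exact K T j).linearMap_comp_eq_zero

variable {D}

theorem koszulComplex_shortExact {K T : Finset (Fin n)} {j : Fin n}
    (h : Function.Injective (D.koszulMap K T j)) : (D.koszulComplex K T j).ShortExact :=
  ModuleCat.shortComplex_shortExact _ (koszul_exact K T j) h (koszulProj_surjective K T j)

variable (D) in
/-- The extension groups of a Koszul module by `Z`. -/
abbrev KoszulExt (K T : Finset (Fin n)) (m : ℕ) : Type u :=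
  Ext (ModuleCat.of Q (D.KoszulModule K T)) (ModuleCat.of Q Z) m

variable {Z}

theorem koszulExt_insert_eq_zero {K T : Finset (Fin n)} {j : Fin n}
    (h : Function.Injective (D.koszulMap K T j))
    (h1 : ∀ m, ∀ x : D.KoszulExt Z (K ∆ {j}) T m, x = 0)
    (h2 : ∀ m, ∀ x : D.KoszulExt Z K T m, x = 0) (m : ℕ) (x : D.KoszulExt Z K (insert j T) m) :
    x = 0 :=
  ext_eq_zero_of_shortExact (koszulComplex_shortExact h) h1 h2 m x

theorem exists_koszulExt_insert_ne_zero {K T : Finset (Fin n)} {j : Fin n} {m : ℕ}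
    (h : Function.Injective (D.koszulMap K T j))
    (h1 : ∃ x : D.KoszulExt Z (K ∆ {j}) T m, x ≠ 0)
    (h2 : ∀ x : D.KoszulExt Z K T m, x = 0) :
    ∃ x : D.KoszulExt Z K (insert j T) (m + 1), x ≠ 0 :=
  exists_ext_ne_zero_of_shortExact (koszulComplex_shortExact h) h1 h2

/-- A map out of Q e_J is determined by the image of its generator, which lies in e_J Z. -/
theorem koszulHom_eq_zero {J : Finset (Fin n)} (hZ : ∀ z : Z, D.e J • z = 0)
    (f : D.KoszulModule J ∅ →ₗ[Q] Z) : f = 0 := by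
  ext
  change f (Submodule.Quotient.mk 1) = 0
  rw [← mk_mul_e, one_mul, ← mul_one (D.e J), ← smul_eq_mul, Submodule.Quotient.mk_smul, map_smul,
    hZ]

theorem koszulExt_empty_eq_zero {J : Finset (Fin n)} (hZ : ∀ z : Z, D.e J • z = 0) (m : ℕ)
    (x : D.KoszulExt Z J ∅ m) : x = 0 := by
  cases m with
  | zero =>
    obtain ⟨f, rfl⟩ := Ext.mk₀_bijective _ _ |>.2 x
    rw [Ext.mk₀_eq_zero_iff]
    exact ModuleCat.hom_ext (koszulHom_eq_zero hZ f.hom)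
  | succ m =>
    have : Projective (ModuleCat.of Q (D.KoszulModule J ∅)) :=
      (IsProjective.iff_projective _).1 inferInstance
    exact Ext.eq_zero_of_projective x

section

variable {V : Finset (Fin n)} (hZ : ∀ J ≠ V, ∀ z : Z, D.e J • z = 0)

include hZ

/-- The resolution behind `pdLE_corner_koszul_of_differ`, now with V as the avoided vertex: no term
is Q e_V, so nothing maps to Z. -/
theorem koszulExt_eq_zero_of_differ {i : Fin n} (T : Finset (Fin n)) (hiT : i ∉ T)
    (J : Finset (Fin n)) (hi : i ∈ J) (hJ : ∃ j ∉ insert i T, j ∈ J ∆ V) (m : ℕ)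
    (x : D.KoszulExt Z J (insert i T) m) : x = 0 := by
  induction T using Finset.induction_on generalizing J m with
  | empty =>
    obtain ⟨j, hj, hjJ⟩ := hJ
    have hji : j ≠ i := by simpa using hj
    refine koszulExt_insert_eq_zero (koszulMap_injective_of_empty hi)
      (koszulExt_empty_eq_zero (hZ _ ?_)) (koszulExt_empty_eq_zero (hZ _ ?_)) m x
    · rintro rfl
      rw [← symmDiff_assoc, symmDiff_self] at hjJ
      simp [Finset.mem_symmDiff, hji] at hjJ
    · rintro rfl
      simp at hjJ
  | insert l T hl ih =>
    obtain ⟨j, hj, hjJ⟩ := hJ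
    have hil : i ≠ l := fun h => hiT (by simp [h])
    have hiT' : i ∉ T := fun h => hiT (by simp [h])
    have hlT : l ∉ insert i T := by simp [hil.symm, hl]
    have hj' : j ∉ insert i T := fun h => hj (by
      rw [Finset.insert_comm]; exact Finset.mem_insert_of_mem h)
    have hjl : j ≠ l := fun h => hj (by simp [h])
    revert x
    rw [Finset.insert_comm]
    refine koszulExt_insert_eq_zero
      (koszulMap_injective_of_mem hi (Finset.mem_insert_self i T) hlT)
      (ih hiT' (J ∆ {l}) (koszul_flip hi (Finset.mem_insert_self i T) hlT) ⟨j, hj', ?_⟩)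
      (ih hiT' J hi ⟨j, hj', hjJ⟩) m
    rw [symmDiff_right_comm, Finset.mem_symmDiff]
    exact Or.inl ⟨hjJ, by simpa using hjl⟩

variable (hV : ∃ z : Z, D.e V • z ≠ 0)

omit hZ in
include hV in
theorem exists_koszulExt_empty_ne_zero : ∃ x : D.KoszulExt Z V ∅ 0, x ≠ 0 := by
  obtain ⟨z, hz⟩ := hV
  let f : D.KoszulModule V ∅ →ₗ[Q] Z := LinearMap.toSpanSingleton Q Z z ∘ₗ D.koszulIncl V
  have hf : f (Submodule.Quotient.mk 1) ≠ 0 := by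
    simpa [f] using hz
  refine ⟨Ext.mk₀ (ModuleCat.ofHom f), fun h => hf ?_⟩
  rw [Ext.mk₀_eq_zero_iff] at h
  exact LinearMap.congr_fun (congrArg ModuleCat.Hom.hom h) _

include hV in
-- Start from Hom(Q e_V, Z) = e_V Z ≠ 0; each new variable flips one element of the vertex and
-- raises the Ext degree by one. The condition i ∉ V puts i in every vertex of the chain, as
-- injectivity requires.
theorem exists_koszulExt_ne_zero {i : Fin n} (hi : i ∉ V) (T : Finset (Fin n)) (hiT : i ∉ T) :
    ∃ x : D.KoszulExt Z (V ∆ insert i T) (insert i T) (insert i T).card, x ≠ 0 := by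
  induction T using Finset.induction_on with
  | empty =>
    have hiV : i ∈ V ∆ {i} := by simp [Finset.mem_symmDiff, hi]
    refine exists_koszulExt_insert_ne_zero (koszulMap_injective_of_empty hiV) ?_
      (koszulExt_empty_eq_zero (hZ _ ?_) 0)
    · rw [insert_empty_eq, symmDiff_symmDiff_cancel_right]
      exact exists_koszulExt_empty_ne_zero hV
    · intro h
      rw [insert_empty_eq, symmDiff_eq_left] at h
      simp at h
  | insert l T hl ih =>
    have hil : i ≠ l := fun h => hiT (by simp [h])
    have hiT' : i ∉ T := fun h => hiT (by simp [h])
    have hlT : l ∉ insert i T := by simp [hil.symm, hl]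
    have hiV : i ∈ V ∆ insert i (insert l T) := by simp [Finset.mem_symmDiff, hi]
    have hflip : (V ∆ insert i (insert l T)) ∆ {l} = V ∆ insert i T := by
      ext a
      by_cases hal : a = l
      · subst hal; simp [Finset.mem_symmDiff, hil.symm, hl]
      · simp [Finset.mem_symmDiff, hal]
    have key := exists_koszulExt_insert_ne_zero
      (koszulMap_injective_of_mem (D := D) hiV (Finset.mem_insert_self i T) hlT)
      (by rw [hflip]; exact ih hiT')
      (koszulExt_eq_zero_of_differ hZ T hiT' _ hiV ⟨l, hlT, by
        rw [symmDiff_right_comm, symmDiff_self, Finset.bot_eq_empty, ← Finset.bot_eq_empty,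
          bot_symmDiff]; simp⟩ _)
    rw [← Finset.card_insert_of_notMem hlT] at key
    rw [Finset.insert_comm] at key ⊢
    convert key using 3

include hV in
/-- A module supported at a single vertex `V ≠ [n]` of the cube has injective dimension at
least `n`. -/
theorem not_hasInjectiveDimensionLT {i : Fin n} (hi : i ∉ V) :
    ¬ HasInjectiveDimensionLT (ModuleCat.of Q Z) n := by
  intro h
  obtain ⟨x, hx⟩ := exists_koszulExt_ne_zero hZ hV hi (Finset.univ.erase i)
    (Finset.notMem_erase i _)
  refine hx (Ext.eq_zero_of_hasInjectiveDimensionLT x n ?_)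
  rw [Finset.insert_erase (Finset.mem_univ i), Finset.card_univ, Fintype.card_fin]

end

/-- The evaluation of a cube ring at the simple module at a vertex. -/
theorem exists_character (D : CubeRing k n Q) {V : Finset (Fin n)} (hV : V.Nonempty) :
    ∃ χ : Q →+* k, χ (D.e V) = 1 ∧ ∀ J ≠ V, χ (D.e J) = 0 := by
  obtain ⟨v, hv⟩ := hV
  -- The character takes the constant term of any p with q e_V = ψ(p) e_V. It is well defined
  -- because t_V has no constant term, V being nonempty.
  choose P hP using D.exists_mul_e
  have hdvd : ∀ p, squarefreeMonomial k V ∣ p → constantCoeff p = 0 := by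
    rintro _ ⟨r, rfl⟩
    rw [map_mul, squarefreeMonomial, map_prod,
      Finset.prod_eq_zero (i := v) hv (by simp), zero_mul]
  have key : ∀ q p, q * D.e V = D.ψ p * D.e V → constantCoeff (P q V) = constantCoeff p := by
    intro q p h
    rw [hP, ← sub_eq_zero, ← sub_mul, ← map_sub, D.ψ_mul_e_eq_zero] at h
    rw [← sub_eq_zero, ← map_sub, hdvd _ h]
  have hpart : ∀ (I : Finset (Fin n)) (p : MvPolynomial (Fin n) k), constantCoeff (parityPart I p) =
      if I = ∅ then constantCoeff p else (0 : k) := by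
    intro I p
    have h0 : parity (0 : Fin n →₀ ℕ) = ∅ := by ext; simp
    simp only [constantCoeff_eq, coeff_parityPart, h0, eq_comm]
  refine ⟨{ toFun := fun q => constantCoeff (P q V)
            map_one' := ?_
            map_mul' := fun q q' => ?_
            map_zero' := ?_
            map_add' := fun q q' => ?_ }, ?_, fun J hJ => ?_⟩
  · rw [key 1 1 (by simp), map_one]
  -- The part of q' e_V in degree I has parity I ∆ V, so only I = V contributes a constant term.
  · rw [key _ (∑ I, P q I * parityPart (I ∆ V) (P q' V)), map_sum]
    · simp only [map_mul, hpart]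
      rw [Finset.sum_eq_single V]
      · simp
      · intro I _ hI
        have hI' : I ∆ V ≠ ∅ := mt symmDiff_eq_bot.1 hI
        rw [if_neg hI', mul_zero]
      · simp
    · rw [mul_assoc, hP q' V, D.eq_sum_mul_e q, Finset.sum_mul, map_sum, Finset.sum_mul]
      refine Finset.sum_congr rfl fun I _ => ?_
      rw [← D.eq_sum_mul_e q, hP q I, mul_assoc, D.e_mul_ψ_mul_e, map_mul, mul_assoc]
  · rw [key 0 0 (by simp), map_zero]
  · rw [key _ (P q V + P q' V) (by rw [add_mul, hP q, hP q', map_add, add_mul]), map_add]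
  · exact (key _ 1 (by simp [D.e_mul_e])).trans (map_one _)
  · exact (key _ 0 (by simp [D.e_mul_e, hJ])).trans (map_zero _)

end CubeRing

end NormalCrossing

end

/-! ### The root ring and its endomorphisms -/

noncomputable section

namespace NormalCrossing

open MvPolynomial

variable {k : Type u} [Field k] {n : ℕ}

theorem parity_two_smul (α : Fin n →₀ ℕ) : parity (2 • α) = ∅ := by
  ext i
  simp

theorem parityPart_expand_mul (I : Finset (Fin n)) (f p : MvPolynomial (Fin n) k) :
    parityPart I (expand 2 f * p) = expand 2 f * parityPart I p := by
  induction f using MvPolynomial.induction_on' with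
  | monomial α a =>
    rw [expand_monomial, parityPart_monomial_mul, parity_two_smul,
      show I ∆ ∅ = I from symmDiff_bot I]
  | add f g hf hg => rw [map_add, add_mul, add_mul, map_add, hf, hg]

/-- Halving exponents writes a monomial of parity J as t_J times a square, so t_J generates this
part over R. -/
theorem exists_parityPart_eq (J : Finset (Fin n)) (p : MvPolynomial (Fin n) k) :
    ∃ s, parityPart J p = expand 2 s * squarefreeMonomial k J := by
  induction p using MvPolynomial.induction_on' with
  | monomial α a =>
    rw [parityPart_monomial]
    split_ifs with h
    · refine ⟨monomial (Finsupp.mapRange (· / 2) rfl α) a, ?_⟩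
      rw [expand_monomial, squarefreeMonomial_eq_monomial, monomial_mul, mul_one]
      congr 2
      ext i
      have hi : i ∈ J ↔ Odd (α i) := by rw [← h, mem_parity]
      simp only [Finsupp.add_apply, Finsupp.smul_apply, Finsupp.mapRange_apply, smul_eq_mul,
        squarefreeExponent_apply, hi]
      split_ifs with h'
      · have := Nat.odd_iff.1 h'; omega
      · have := Nat.even_iff.1 (Nat.not_odd_iff_even.1 h'); omega
    · exact ⟨0, by simp⟩
  | add p q hp hq =>
    obtain ⟨s, hs⟩ := hp
    obtain ⟨t, ht⟩ := hq
    exact ⟨s + t, by rw [map_add, map_add, hs, ht, add_mul]⟩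

theorem expand_two_squarefreeMonomial (I : Finset (Fin n)) :
    expand 2 (squarefreeMonomial k I) = squarefreeMonomial k I * squarefreeMonomial k I := by
  simp [squarefreeMonomial, map_prod, pow_two, Finset.prod_mul_distrib]

theorem squarefreeMonomial_mul_compl (I : Finset (Fin n)) :
    squarefreeMonomial k I * squarefreeMonomial k Iᶜ = squarefreeMonomial k Finset.univ :=
  Finset.prod_mul_prod_compl I _

variable (k n) in
/-- The ring `k[t₁, …, tₙ] / (t₁ ⋯ tₙ)` as an algebra over `k[x₁, …, xₙ] / (x₁ ⋯ xₙ)` through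
`xᵢ ↦ tᵢ²`. -/
def RootRing : Type u := NCRing k n

instance : CommRing (RootRing k n) := inferInstanceAs (CommRing (NCRing k n))

variable (k n) in
/-- The projection from the polynomial ring. -/
def rootMk : MvPolynomial (Fin n) k →+* RootRing k n := Ideal.Quotient.mk _

theorem rootMk_surjective : Function.Surjective (rootMk k n) := Ideal.Quotient.mk_surjective

theorem rootMk_eq_zero_iff {p : MvPolynomial (Fin n) k} :
    rootMk k n p = 0 ↔ squarefreeMonomial k Finset.univ ∣ p :=
  Ideal.Quotient.eq_zero_iff_mem.trans Ideal.mem_span_singleton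

instance : Algebra (NCRing k n) (RootRing k n) :=
  RingHom.toAlgebra (Ideal.Quotient.lift _ ((rootMk k n).comp (expand 2).toRingHom) (by
    intro a ha
    obtain ⟨b, rfl⟩ := Ideal.mem_span_singleton.1 ha
    change rootMk k n (expand 2 (squarefreeMonomial k Finset.univ * b)) = 0
    rw [map_mul, expand_two_squarefreeMonomial, mul_assoc, rootMk_eq_zero_iff]
    exact Dvd.intro _ rfl))

variable (k n) in
/-- The projection onto the normal crossing ring. -/
abbrev ncMk : MvPolynomial (Fin n) k →+* NCRing k n := Ideal.Quotient.mk _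

theorem ncMk_smul (f p : MvPolynomial (Fin n) k) :
    ncMk k n f • rootMk k n p = rootMk k n (expand 2 f * p) := by
  rw [Algebra.smul_def, map_mul]
  rfl

theorem rootMk_parityPart_congr (I : Finset (Fin n)) {p q : MvPolynomial (Fin n) k}
    (h : rootMk k n p = rootMk k n q) :
    rootMk k n (parityPart I p) = rootMk k n (parityPart I q) := by
  rw [← sub_eq_zero, ← map_sub, rootMk_eq_zero_iff] at h ⊢
  obtain ⟨r, hr⟩ := h
  rw [← map_sub, hr, parityPart_squarefreeMonomial_mul]
  exact Dvd.intro _ rfl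

/-- The component of parity `I` of an element of the root ring. -/
def rootPart (I : Finset (Fin n)) : RootRing k n →ₗ[NCRing k n] RootRing k n where
  toFun x := rootMk k n (parityPart I (Function.surjInv rootMk_surjective x))
  map_add' x y := by
    rw [← map_add, ← map_add]
    apply rootMk_parityPart_congr
    simp only [map_add, Function.surjInv_eq]
  map_smul' r x := by
    obtain ⟨f, rfl⟩ := Ideal.Quotient.mk_surjective r
    rw [RingHom.id_apply, ncMk_smul, ← parityPart_expand_mul]
    apply rootMk_parityPart_congr
    simp only [← ncMk_smul, Function.surjInv_eq]

@[simp]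
theorem rootPart_rootMk (I : Finset (Fin n)) (p : MvPolynomial (Fin n) k) :
    rootPart I (rootMk k n p) = rootMk k n (parityPart I p) :=
  rootMk_parityPart_congr I (Function.surjInv_eq _ _)

theorem rootPart_comp_rootPart (I J : Finset (Fin n)) :
    rootPart I ∘ₗ rootPart J = if I = J then (rootPart J : RootRing k n →ₗ[_] _) else 0 := by
  ext x
  obtain ⟨p, rfl⟩ := rootMk_surjective x
  simp only [LinearMap.comp_apply, rootPart_rootMk, parityPart_parityPart]
  split_ifs <;> simp

theorem sum_rootPart : ∑ I, (rootPart I : RootRing k n →ₗ[_] _) = LinearMap.id := by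
  ext x
  obtain ⟨p, rfl⟩ := rootMk_surjective x
  simp only [LinearMap.sum_apply, rootPart_rootMk, LinearMap.id_apply]
  rw [← map_sum, sum_parityPart]

theorem rootRing_hom_ext {N : Type*} [AddCommGroup N] [Module (NCRing k n) N]
    {f g : RootRing k n →ₗ[NCRing k n] N}
    (h : ∀ J, f (rootMk k n (squarefreeMonomial k J)) = g (rootMk k n (squarefreeMonomial k J))) :
    f = g := by
  ext x
  obtain ⟨p, rfl⟩ := rootMk_surjective x
  rw [← sum_parityPart p, map_sum, map_sum, map_sum]
  refine Finset.sum_congr rfl fun J _ => ?_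
  obtain ⟨s, hs⟩ := exists_parityPart_eq J p
  rw [hs, ← ncMk_smul, map_smul, map_smul, h]

/-- Anything in S killed by x_{Jᶜ} is a multiple of t_J. This limits where an R-linear map can send
t_J. -/
theorem squarefreeMonomial_dvd_of_univ_dvd {J : Finset (Fin n)} {w : MvPolynomial (Fin n) k}
    (h : squarefreeMonomial k Finset.univ ∣ expand 2 (squarefreeMonomial k Jᶜ) * w) :
    squarefreeMonomial k J ∣ w := by
  rw [squarefreeMonomial_dvd_iff] at h ⊢
  intro α hα i hi
  have := h (2 • squarefreeExponent Jᶜ + α) (by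
    rw [squarefreeMonomial_eq_monomial, expand_monomial, coeff_monomial_mul, one_mul]
    exact hα) i (Finset.mem_univ i)
  simpa [hi] using this

/-- The annihilator of t_{Iᶜ} in R is generated by x_I, which makes the embedding of R/(x_I)
injective. -/
theorem squarefreeMonomial_dvd_of_univ_dvd_expand {I : Finset (Fin n)}
    {s : MvPolynomial (Fin n) k}
    (h : squarefreeMonomial k Finset.univ ∣ expand 2 s * squarefreeMonomial k Iᶜ) :
    squarefreeMonomial k I ∣ s := by
  rw [squarefreeMonomial_dvd_iff] at h ⊢
  intro α hα i hi
  have := h (squarefreeExponent Iᶜ + 2 • α) (by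
    rw [mul_comm, squarefreeMonomial_eq_monomial, coeff_monomial_mul, one_mul]
    rwa [coeff_expand_smul _ two_ne_zero]) i (Finset.mem_univ i)
  simpa [hi] using this

theorem squarefreeMonomial_mul_smul (I : Finset (Fin n)) :
    ncMk k n (squarefreeMonomial k I) • rootMk k n (squarefreeMonomial k Iᶜ) = 0 := by
  rw [ncMk_smul, expand_two_squarefreeMonomial, mul_assoc, squarefreeMonomial_mul_compl,
    rootMk_eq_zero_iff]
  exact Dvd.intro_left _ rfl

theorem univ_dvd_parityPart_univ (p : MvPolynomial (Fin n) k) :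
    squarefreeMonomial k Finset.univ ∣ parityPart Finset.univ p := by
  obtain ⟨s, hs⟩ := exists_parityPart_eq Finset.univ p
  exact hs ▸ Dvd.intro_left _ rfl

/-- Multiplication by polynomials on the root ring, as a map to the opposite endomorphism ring. -/
def rootMul : MvPolynomial (Fin n) k →+* (Module.End (NCRing k n) (RootRing k n))ᵐᵒᵖ :=
  ((Algebra.lmul (NCRing k n) (RootRing k n)).toRingHom.comp (rootMk k n)).toOpposite
    fun x y => by
      change _ * _ = _ * _
      rw [← map_mul, mul_comm, map_mul]

@[simp]
theorem unop_rootMul_apply (p : MvPolynomial (Fin n) k) (x : RootRing k n) :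
    (rootMul p).unop x = rootMk k n p * x := rfl

/-- The cube ring structure on the opposite endomorphism ring of the root ring. -/
def rootCubeRing : CubeRing k n (Module.End (NCRing k n) (RootRing k n))ᵐᵒᵖ where
  ψ := rootMul
  -- The complement matches e_K with the summand R/(x_K); vertex ∅ gets parity [n], a part that is
  -- zero in S.
  e K := MulOpposite.op (rootPart Kᶜ)
  e_mul_e I J := by
    rw [← MulOpposite.op_mul, Module.End.mul_eq_comp, rootPart_comp_rootPart]
    by_cases h : I = J
    · simp [h]
    · simp [h, Ne.symm h]
  sum_e := by
    rw [← Finset.op_sum, ← MulOpposite.op_one]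
    congr 1
    exact (Fintype.sum_equiv (Equiv.ofBijective _ compl_bijective) _ _ fun I => rfl).trans
      sum_rootPart
  C_mul_e a K := by
    apply MulOpposite.unop_injective
    ext x
    obtain ⟨p, rfl⟩ := rootMk_surjective x
    simp [← map_mul, parityPart_C_mul]
  X_mul_e i K := by
    apply MulOpposite.unop_injective
    ext x
    obtain ⟨p, rfl⟩ := rootMk_surjective x
    have : (K ∆ {i})ᶜ = Kᶜ ∆ {i} := by
      ext j; simp only [Finset.mem_compl, Finset.mem_symmDiff, Finset.mem_singleton]; tauto
    simp [← map_mul, parityPart_X_mul, this]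
  exists_mul_e a K := by
    have h : ∀ J, ∃ r, a.unop (rootMk k n (squarefreeMonomial k J)) =
        rootMk k n (squarefreeMonomial k J * r) := by
      intro J
      obtain ⟨w, hw⟩ := rootMk_surjective (a.unop (rootMk k n (squarefreeMonomial k J)))
      have h0 := congrArg a.unop (squarefreeMonomial_mul_smul (k := k) Jᶜ)
      rw [compl_compl, map_smul, ← hw, map_zero, ncMk_smul, rootMk_eq_zero_iff] at h0
      obtain ⟨r, rfl⟩ := squarefreeMonomial_dvd_of_univ_dvd h0
      exact ⟨r, hw.symm⟩
    choose r hr using h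
    -- With a(t_J) = t_J r_J, the parity-Kᶜ part of a(t_J) sees only the (Kᶜ ∆ J)-part of r_J. These
    -- parities are distinct, so one polynomial serves every J.
    refine ⟨∑ J, parityPart (Kᶜ ∆ J) (r J), ?_⟩
    apply MulOpposite.unop_injective
    refine rootRing_hom_ext fun J => ?_
    simp only [MulOpposite.unop_mul, MulOpposite.unop_op, Module.End.mul_apply, unop_rootMul_apply]
    rw [hr, ← map_mul, mul_comm (∑ J, _), rootPart_rootMk, rootPart_rootMk,
      parityPart_squarefreeMonomial_mul, parityPart_squarefreeMonomial_mul, map_sum]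
    congr 2
    rw [Finset.sum_eq_single J]
    · rw [parityPart_parityPart, if_pos rfl]
    · intro I _ hI
      rw [parityPart_parityPart, if_neg]
      simpa using hI.symm
    · simp
  ψ_mul_e_eq_zero p K := by
    have h : rootMul p * MulOpposite.op (rootPart Kᶜ) = 0 ↔
        ∀ q, squarefreeMonomial k Finset.univ ∣ parityPart Kᶜ (q * p) := by
      rw [← MulOpposite.unop_inj, LinearMap.ext_iff, rootMk_surjective.forall]
      refine forall_congr' fun q => ?_
      rw [← rootMk_eq_zero_iff, mul_comm q, ← rootPart_rootMk, map_mul]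
      rfl
    rw [h]
    constructor
    · intro h
      rw [squarefreeMonomial_dvd_iff]
      intro α hα i hi h0
      -- Test monomial: multiplication by it moves α to parity Kᶜ without introducing tᵢ, as i ∈ K
      -- and α i = 0.
      have h1 := h (squarefreeMonomial k (Kᶜ ∆ parity α))
      rw [parityPart_squarefreeMonomial_mul, symmDiff_symmDiff_cancel_left,
        squarefreeMonomial_dvd_iff] at h1
      have h2 := h1 (squarefreeExponent (Kᶜ ∆ parity α) + α) (by
        rw [squarefreeMonomial_eq_monomial, coeff_monomial_mul, one_mul, coeff_parityPart,
          if_pos rfl]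
        exact hα) i (Finset.mem_univ i)
      simp [Finset.mem_symmDiff, hi, h0] at h2
    · rintro ⟨r, rfl⟩ q
      have h1 : Kᶜ ∆ K = Finset.univ := compl_symmDiff_self K
      rw [mul_left_comm, parityPart_squarefreeMonomial_mul, h1]
      exact (univ_dvd_parityPart_univ _).mul_left _

end NormalCrossing

end

/-! ### The full and partial modules inside the root ring -/

noncomputable section

namespace NormalCrossing

open MvPolynomial

variable {k : Type u} [Field k] {n : ℕ}

/-- Transport of a cube ring structure along a ring isomorphism. -/
def CubeRing.congr {Q Q' : Type u} [Ring Q] [Ring Q'] (D : CubeRing k n Q) (f : Q ≃+* Q') :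
    CubeRing k n Q' where
  ψ := (f : Q →+* Q').comp D.ψ
  e K := f (D.e K)
  e_mul_e I J := by
    rw [← map_mul, D.e_mul_e]
    split_ifs <;> simp
  sum_e := by rw [← map_sum, D.sum_e, map_one]
  C_mul_e a K := by
    change f _ * f _ = f _ * f _
    rw [← map_mul, D.C_mul_e, map_mul]
  X_mul_e i K := by
    change f _ * f _ = f _ * f _
    rw [← map_mul, D.X_mul_e, map_mul]
  exists_mul_e q K := by
    obtain ⟨p, hp⟩ := D.exists_mul_e (f.symm q) K
    refine ⟨p, ?_⟩
    change _ = f _ * f _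
    rw [← map_mul, ← hp, map_mul, f.apply_symm_apply]
  ψ_mul_e_eq_zero p K := by
    rw [← D.ψ_mul_e_eq_zero]
    change f _ * f _ = 0 ↔ _
    rw [← map_mul, map_eq_zero_iff f f.injective]

/-- The map from a cyclic module to the root ring sending the generator to the complementary
squarefree monomial. -/
def cyclicRootMap (I : Finset (Fin n)) : CyclicModule k n I →ₗ[NCRing k n] RootRing k n :=
  Submodule.liftQ (Ideal.span {monomialClass k n I})
    (LinearMap.toSpanSingleton (NCRing k n) _ (rootMk k n (squarefreeMonomial k Iᶜ))) (by
      refine (Submodule.span_singleton_le_iff_mem _ _).2 ?_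
      exact squarefreeMonomial_mul_smul I)

variable (k n) in
/-- The class of a polynomial in a cyclic module. -/
def cyclicMk (I : Finset (Fin n)) (p : MvPolynomial (Fin n) k) : CyclicModule k n I :=
  Submodule.Quotient.mk (ncMk k n p)

theorem cyclicMk_surjective (I : Finset (Fin n)) : Function.Surjective (cyclicMk k n I) :=
  (Submodule.Quotient.mk_surjective _).comp Ideal.Quotient.mk_surjective

theorem cyclicRootMap_cyclicMk (I : Finset (Fin n)) (p : MvPolynomial (Fin n) k) :
    cyclicRootMap I (cyclicMk k n I p) = rootMk k n (expand 2 p * squarefreeMonomial k Iᶜ) :=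
  ncMk_smul _ _

theorem cyclicRootMap_injective (I : Finset (Fin n)) :
    Function.Injective (cyclicRootMap I : CyclicModule k n I →ₗ[_] _) := by
  rw [injective_iff_map_eq_zero]
  intro x hx
  obtain ⟨p, rfl⟩ := cyclicMk_surjective I x
  rw [cyclicRootMap_cyclicMk, rootMk_eq_zero_iff] at hx
  obtain ⟨q, rfl⟩ := squarefreeMonomial_dvd_of_univ_dvd_expand hx
  refine (Submodule.Quotient.mk_eq_zero _).2 ?_
  rw [map_mul]
  exact Ideal.mul_mem_right _ _ (Ideal.subset_span rfl)

theorem rootPart_cyclicRootMap (I J : Finset (Fin n)) (x : CyclicModule k n J) :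
    rootPart Iᶜ (cyclicRootMap J x) = if I = J then cyclicRootMap J x else 0 := by
  obtain ⟨p, rfl⟩ := cyclicMk_surjective J x
  have h : parityPart Iᶜ (squarefreeMonomial k Jᶜ) =
      if I = J then squarefreeMonomial k Jᶜ else 0 := by
    rw [squarefreeMonomial_eq_monomial, parityPart_monomial, parity_squarefreeExponent]
    simp [eq_comm]
  rw [cyclicRootMap_cyclicMk, rootPart_rootMk, parityPart_expand_mul, h]
  split_ifs <;> simp

variable (k n) in
/-- The comparison map from the full module to the root ring. -/
def fullRootMap : FullModule k n →ₗ[NCRing k n] RootRing k n :=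
  DirectSum.toModule _ _ _ cyclicRootMap

@[simp]
theorem fullRootMap_lof (I : Finset (Fin n)) (x : CyclicModule k n I) :
    fullRootMap k n (DirectSum.lof (NCRing k n) _ (CyclicModule k n) I x) = cyclicRootMap I x :=
  DirectSum.toModule_lof ..

variable (k n) in
/-- The projection of the full module onto one of its components. -/
def fullProj (K : Finset (Fin n)) : Module.End (NCRing k n) (FullModule k n) :=
  DirectSum.lof (NCRing k n) _ (CyclicModule k n) K ∘ₗ DirectSum.component _ _ _ K

theorem rootPart_fullRootMap (K : Finset (Fin n)) (x : FullModule k n) :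
    rootPart Kᶜ (fullRootMap k n x) = fullRootMap k n (fullProj k n K x) := by
  suffices h : rootPart Kᶜ ∘ₗ fullRootMap k n = fullRootMap k n ∘ₗ fullProj k n K from
    LinearMap.congr_fun h x
  refine DirectSum.linearMap_ext _ fun J => LinearMap.ext fun x => ?_
  simp only [LinearMap.comp_apply, fullRootMap_lof, rootPart_cyclicRootMap, fullProj]
  split_ifs with h
  · subst h
    rw [DirectSum.component.lof_self]
  · rw [DirectSum.component.of, dif_neg (Ne.symm h), map_zero]

/-- The summands embed into distinct parity parts of S, and each part is generated by its squarefree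
monomial. -/
theorem fullRootMap_bijective : Function.Bijective (fullRootMap k n) := by
  constructor
  · rw [injective_iff_map_eq_zero]
    intro x hx
    refine DirectSum.ext_component (NCRing k n) fun K => ?_
    apply cyclicRootMap_injective K
    rw [← fullRootMap_lof, map_zero, map_zero]
    exact (rootPart_fullRootMap K x).symm.trans (by rw [hx, map_zero])
  · intro x
    obtain ⟨p, rfl⟩ := rootMk_surjective x
    rw [← LinearMap.mem_range, ← sum_parityPart p, map_sum]
    refine Submodule.sum_mem _ fun J _ => ?_
    obtain ⟨s, hs⟩ := exists_parityPart_eq J p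
    refine ⟨DirectSum.lof (NCRing k n) _ (CyclicModule k n) Jᶜ (cyclicMk k n Jᶜ s), ?_⟩
    rw [fullRootMap_lof, cyclicRootMap_cyclicMk, compl_compl, hs]

variable (k n) in
/-- The full module is isomorphic to the root ring. -/
def fullRootEquiv : FullModule k n ≃ₗ[NCRing k n] RootRing k n :=
  LinearEquiv.ofBijective _ fullRootMap_bijective

variable (k n) in
/-- The cube ring structure on the opposite endomorphism ring of the full module. -/
def fullCubeRing : CubeRing k n (Module.End (NCRing k n) (FullModule k n))ᵐᵒᵖ :=
  rootCubeRing.congr (RingEquiv.op (fullRootEquiv k n).symm.conjRingEquiv)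

theorem fullCubeRing_e (K : Finset (Fin n)) :
    (fullCubeRing k n).e K = MulOpposite.op (fullProj k n K) := by
  apply MulOpposite.unop_injective
  refine LinearMap.ext fun x => (fullRootEquiv k n).injective ?_
  exact ((fullRootEquiv k n).apply_symm_apply _).trans (rootPart_fullRootMap K x)

variable (k n) in
/-- The inclusion of the partial sum into the full module. -/
def omitIncl (K : Finset (Fin n)) : OmitModule k n K →ₗ[NCRing k n] FullModule k n :=
  DirectSum.toModule _ _ _ fun I => DirectSum.lof (NCRing k n) _ (CyclicModule k n) I.1

variable (k n) in
/-- The projection of the full module onto the partial sum. -/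
def omitProj (K : Finset (Fin n)) : FullModule k n →ₗ[NCRing k n] OmitModule k n K :=
  DirectSum.toModule _ _ _ fun I =>
    if h : I = K then 0 else
      DirectSum.lof (NCRing k n) _ (fun I : {I // I ≠ K} => CyclicModule k n I.1) ⟨I, h⟩

theorem omitProj_comp_omitIncl (K : Finset (Fin n)) :
    omitProj k n K ∘ₗ omitIncl k n K = LinearMap.id := by
  refine DirectSum.linearMap_ext _ fun J => LinearMap.ext fun x => ?_
  simp only [LinearMap.comp_apply, omitIncl, omitProj, DirectSum.toModule_lof, dif_neg J.2,
    LinearMap.id_apply]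

theorem omitIncl_comp_omitProj (K : Finset (Fin n)) :
    omitIncl k n K ∘ₗ omitProj k n K = 1 - fullProj k n K := by
  refine DirectSum.linearMap_ext _ fun J => LinearMap.ext fun x => ?_
  simp only [LinearMap.comp_apply, omitIncl, omitProj, DirectSum.toModule_lof,
    LinearMap.sub_apply, Module.End.one_apply, fullProj]
  by_cases h : J = K
  · subst h
    rw [dif_pos rfl, DirectSum.component.lof_self]
    simp
  · rw [dif_neg h, DirectSum.toModule_lof, DirectSum.component.of, dif_neg h, map_zero, sub_zero]

theorem omitProj_omitIncl_apply (K : Finset (Fin n)) (x : OmitModule k n K) :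
    omitProj k n K (omitIncl k n K x) = x :=
  LinearMap.congr_fun (omitProj_comp_omitIncl K) x

variable (k n) in
/-- The corner inclusion of the opposite endomorphism rings. -/
def omitEnd (K : Finset (Fin n)) : (Module.End (NCRing k n) (OmitModule k n K))ᵐᵒᵖ →ₙ+*
    (Module.End (NCRing k n) (FullModule k n))ᵐᵒᵖ where
  toFun b := MulOpposite.op (omitIncl k n K ∘ₗ b.unop ∘ₗ omitProj k n K)
  map_mul' a b := by
    apply MulOpposite.unop_injective
    refine LinearMap.ext fun x => ?_
    simp [omitProj_omitIncl_apply]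
  map_zero' := by simp
  map_add' a b := by
    apply MulOpposite.unop_injective
    refine LinearMap.ext fun x => ?_
    simp

theorem omitEnd_one (K : Finset (Fin n)) : omitEnd k n K 1 = 1 - (fullCubeRing k n).e K := by
  rw [fullCubeRing_e]
  exact congrArg MulOpposite.op (omitIncl_comp_omitProj K)

theorem omitEnd_injective (K : Finset (Fin n)) : Function.Injective (omitEnd k n K) := by
  intro a b h
  apply MulOpposite.unop_injective
  refine LinearMap.ext fun x => ?_
  have := congrArg (omitProj k n K) (LinearMap.congr_fun (congrArg MulOpposite.unop h)
    (omitIncl k n K x))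
  change omitProj k n K (omitIncl k n K (a.unop (omitProj k n K (omitIncl k n K x)))) =
    omitProj k n K (omitIncl k n K (b.unop (omitProj k n K (omitIncl k n K x)))) at this
  simpa only [omitProj_omitIncl_apply] using this

theorem omitEnd_full (K : Finset (Fin n)) (q : (Module.End (NCRing k n) (FullModule k n))ᵐᵒᵖ) :
    ∃ b, omitEnd k n K b = omitEnd k n K 1 * q * omitEnd k n K 1 :=
  ⟨MulOpposite.op (omitProj k n K ∘ₗ q.unop ∘ₗ omitIncl k n K), rfl⟩

theorem pdLE_end_full (hn : 1 ≤ n) (X : Type u) [AddCommGroup X]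
    [Module (Module.End (NCRing k n) (FullModule k n))ᵐᵒᵖ X] :
    PdLE (Module.End (NCRing k n) (FullModule k n))ᵐᵒᵖ X n :=
  (fullCubeRing k n).pdLE X hn

theorem pdLE_end_omit (hn : 1 ≤ n) (K : Finset (Fin n)) (X : Type u) [AddCommGroup X]
    [Module (Module.End (NCRing k n) (OmitModule k n K))ᵐᵒᵖ X] :
    PdLE (Module.End (NCRing k n) (OmitModule k n K))ᵐᵒᵖ X (2 * n - 1) :=
  CubeRing.pdLE_of_omit (omitEnd_injective K) (omitEnd_full K) (omitEnd_one K) hn X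

end NormalCrossing

end

/-! ### Central localization and injective dimension -/

noncomputable section

namespace NormalCrossing

open CategoryTheory

/-- A ring homomorphism that inverts a submonoid of central elements universally. -/
structure IsCentralLocalization {Q Q' : Type u} [Ring Q] [Ring Q'] (T : Submonoid Q)
    (φ : Q →+* Q') : Prop where
  comm : ∀ t ∈ T, ∀ q, t * q = q * t
  isUnit : ∀ t ∈ T, IsUnit (φ t)
  surj : ∀ x, ∃ t ∈ T, ∃ q, φ t * x = φ q
  exists_of_eq : ∀ q r, φ q = φ r → ∃ t ∈ T, t * q = t * r

namespace IsCentralLocalization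

variable {Q Q' : Type u} [Ring Q] [Ring Q'] {T : Submonoid Q} {φ : Q →+* Q'}
variable (h : IsCentralLocalization T φ)

include h

theorem map_comm {t : Q} (ht : t ∈ T) (x : Q') : φ t * x = x * φ t := by
  obtain ⟨s, hs, q, hq⟩ := h.surj x
  apply (h.isUnit s hs).mul_left_cancel
  rw [← mul_assoc, ← mul_assoc, ← map_mul, h.comm s hs, map_mul, mul_assoc, hq, ← map_mul,
    h.comm t ht, map_mul]

/-- The left ideal generated by the image of a left ideal. -/
def idealMap (I : Ideal Q) : Ideal Q' where
  carrier := {x | ∃ t ∈ T, ∃ a ∈ I, φ t * x = φ a}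
  zero_mem' := ⟨1, T.one_mem, 0, I.zero_mem, by simp⟩
  add_mem' := by
    rintro x y ⟨s, hs, a, ha, hx⟩ ⟨t, ht, b, hb, hy⟩
    refine ⟨s * t, T.mul_mem hs ht, t * a + s * b,
      I.add_mem (I.mul_mem_left _ ha) (I.mul_mem_left _ hb), ?_⟩
    rw [map_mul, mul_add, map_add, map_mul, map_mul, ← hx, ← hy, mul_assoc (φ s) (φ t) y,
      h.map_comm hs (φ t), mul_assoc]
  smul_mem' := by
    rintro p x ⟨s, hs, a, ha, hx⟩
    obtain ⟨t, ht, q, hq⟩ := h.surj p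
    refine ⟨t * s, T.mul_mem ht hs, q * a, I.mul_mem_left _ ha, ?_⟩
    rw [map_mul, map_mul, smul_eq_mul, ← hq, ← hx, mul_assoc, mul_assoc, ← mul_assoc (φ s),
      h.map_comm hs, mul_assoc]

variable {E : Type u} [AddCommGroup E] [Module Q' E] [Module Q E]

omit [Module Q E] in
theorem smul_cancel {t : Q} (ht : t ∈ T) {y z : E} (hyz : φ t • y = φ t • z) : y = z := by
  obtain ⟨v, hv⟩ := h.isUnit t ht
  rw [← hv] at hyz
  exact smul_left_cancel v hyz

variable (hE : ∀ (q : Q) (y : E), q • y = φ q • y)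

include hE

/-- For x = s⁻¹b the value must be s⁻¹g(b); two presentations of x agree after multiplication by an
element of T, which acts invertibly on E. -/
theorem exists_extend {I : Ideal Q} (g : I →ₗ[Q] E) (x : h.idealMap I) :
    ∃ y : E, ∀ t ∈ T, ∀ a : I, φ t * x.1 = φ a → φ t • y = g a := by
  obtain ⟨x, s, hs, b, hb, hx⟩ := x
  obtain ⟨v, hv⟩ := h.isUnit s hs
  refine ⟨(↑v⁻¹ : Q') • g ⟨b, hb⟩, fun t ht a hta => ?_⟩
  obtain ⟨w, hw, hwe⟩ := h.exists_of_eq (t * b) (s * a) (by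
    rw [map_mul, map_mul, ← hx, ← hta, ← mul_assoc, ← mul_assoc, h.map_comm ht])
  have hg : w • t • g ⟨b, hb⟩ = w • s • g a := by
    simp only [smul_smul, ← map_smul]
    congr 1
    refine Subtype.ext ?_
    change w * t * b = w * s * a.1
    rw [mul_assoc, hwe, mul_assoc]
  simp only [hE] at hg
  have hg' := h.smul_cancel hw hg
  apply h.smul_cancel hs
  rw [← hg', smul_smul, h.map_comm hs, mul_smul, ← hv, smul_smul (v : Q'), v.mul_inv, one_smul]

/-- A map on a left ideal of Q extends to the fractions of that ideal in Q', then to Q' by Baer's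
criterion there, and is pulled back along φ. No noetherian assumption enters. -/
theorem baer (hB : Module.Baer Q' E) : Module.Baer Q E := by
  intro I g
  choose f hf using h.exists_extend hE g
  obtain ⟨g', hg'⟩ := hB (h.idealMap I)
    { toFun := f
      map_add' := by
        rintro ⟨x, s, hs, a, ha, hx⟩ ⟨y, t, ht, b, hb, hy⟩
        apply h.smul_cancel (T.mul_mem hs ht)
        have hst : φ (s * t) * x = φ (t * a) := by
          rw [h.comm s hs, map_mul, map_mul, mul_assoc, hx]
        have hst' : φ (s * t) * y = φ (s * b) := by
          rw [map_mul, map_mul, mul_assoc, hy]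
        rw [hf _ _ (T.mul_mem hs ht) (t • ⟨a, ha⟩ + s • ⟨b, hb⟩) (by
          change φ (s * t) * (x + y) = φ (t * a + s * b)
          rw [mul_add, map_add, hst, hst']), smul_add, hf _ _ (T.mul_mem hs ht) (t • ⟨a, ha⟩) hst,
          hf _ _ (T.mul_mem hs ht) (s • ⟨b, hb⟩) hst', map_add]
      map_smul' := by
        intro p x
        obtain ⟨s, hs, a, ha, hx⟩ := x.2
        obtain ⟨t, ht, q, hq⟩ := h.surj p
        rw [RingHom.id_apply]
        apply h.smul_cancel (T.mul_mem ht hs)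
        rw [hf _ _ (T.mul_mem ht hs) (q • ⟨a, ha⟩) (by
          change φ (t * s) * (p * x.1) = φ (q * a)
          rw [map_mul, map_mul, ← hq, ← hx, mul_assoc, mul_assoc, ← mul_assoc (φ s),
            h.map_comm hs, mul_assoc]), map_smul, hE, ← hq, ← hf x s hs ⟨a, ha⟩ hx, smul_smul,
          smul_smul, map_mul, mul_assoc, mul_assoc, h.map_comm hs p] }
  refine ⟨{ toFun := fun q => g' (φ q)
            map_add' := fun q r => by rw [map_add, map_add]
            map_smul' := fun q r => by
              rw [smul_eq_mul, map_mul, ← smul_eq_mul, map_smul, RingHom.id_apply, hE] }, ?_⟩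
  intro q hq
  have hm : φ q ∈ h.idealMap I := ⟨1, T.one_mem, q, hq, by simp⟩
  have := hf ⟨φ q, hm⟩ 1 T.one_mem ⟨q, hq⟩ (by simp)
  rw [map_one, one_smul] at this
  exact (hg' _ hm).trans this

omit hE

theorem preservesInjectiveObjects :
    (ModuleCat.restrictScalars.{u} φ).PreservesInjectiveObjects where
  injective_obj {X} hX := by
    rw [← Module.injective_iff_injective_object] at hX ⊢
    exact (h.baer (E := (ModuleCat.restrictScalars.{u} φ).obj X) (fun _ _ => rfl)
      (Module.Baer.of_injective hX)).injective

end IsCentralLocalization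

section

universe w v w' v'

variable {C : Type v} [Category.{w} C] [Abelian C] {D : Type v'} [Category.{w'} D] [Abelian D]
  [EnoughInjectives C]

/-- Cosyzygy induction: an exact functor preserving injectives carries X → I → I/X to a sequence of
the same kind. -/
theorem hasInjectiveDimensionLE_obj (F : C ⥤ D) [F.Additive] [Limits.PreservesFiniteLimits F]
    [Limits.PreservesFiniteColimits F] [F.PreservesInjectiveObjects] (n : ℕ) (X : C)
    (hX : HasInjectiveDimensionLE X n) : HasInjectiveDimensionLE (F.obj X) n := by
  induction n generalizing X with
  | zero =>
    have hX' : Injective X := injective_iff_hasInjectiveDimensionLT_one.2 hX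
    exact injective_iff_hasInjectiveDimensionLT_one.1 (F.injective_obj X)
  | succ n ih =>
    let S : ShortComplex C :=
      ⟨Injective.ι X, Limits.cokernel.π (Injective.ι X), Limits.cokernel.condition _⟩
    have hS : S.ShortExact :=
      { exact := ShortComplex.exact_of_g_is_cokernel _
          (Limits.cokernelIsCokernel (Injective.ι X)) }
    have h3 := ih S.X₃ ((hS.hasInjectiveDimensionLT_X₃_iff n inferInstance).2 hX)
    exact ((hS.map_of_exact F).hasInjectiveDimensionLT_X₃_iff n
      (F.injective_obj (Injective.under X))).1 h3

end

theorem globalDimension_le_iff {A : Type u} [Ring A] {m : ℕ} :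
    globalDimension A ≤ m ↔ ∀ X : ModuleCat.{u} Aᵐᵒᵖ, HasProjectiveDimensionLE X m :=
  iSup_le_iff.trans (forall_congr' fun X => projectiveDimension_le_iff X m)

theorem hasInjectiveDimensionLE_of_globalDimension_le {A : Type u} [Ring A] {m : ℕ}
    (h : globalDimension A ≤ m) (Z : ModuleCat.{u} Aᵐᵒᵖ) : HasInjectiveDimensionLE Z m := by
  let := HasExt.standard (ModuleCat.{u} Aᵐᵒᵖ)
  refine HasInjectiveDimensionLT.mk fun i hi Y e => ?_
  have := globalDimension_le_iff.1 h Y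
  exact Abelian.Ext.eq_zero_of_hasProjectiveDimensionLT e (m + 1) hi

end NormalCrossing

end

/-! ### Global dimension, Krull dimension and supports -/

noncomputable section

namespace NormalCrossing

open CategoryTheory MvPolynomial

variable {k : Type u} [Field k] {n : ℕ}

instance preservesFiniteLimits_restrictScalars {Q Q' : Type u} [Ring Q] [Ring Q'] (φ : Q →+* Q') :
    Limits.PreservesFiniteLimits (ModuleCat.restrictScalars.{u} φ) :=
  ⟨fun _ _ _ => { preservesLimit := inferInstance }⟩

/-- The module k defined by χ would have injective dimension at most m over the localization, hence
over Q, where it is concentrated at V ≠ [n] and so needs at least n. -/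
theorem CubeRing.not_globalDimension_le {Q B : Type u} [Ring Q] [Ring B] (D : CubeRing k n Q)
    {T : Submonoid Q} {φ : Q →+* Bᵐᵒᵖ} (h : IsCentralLocalization T φ) (χ : Bᵐᵒᵖ →+* k)
    {V : Finset (Fin n)} (hV : χ (φ (D.e V)) = 1) (hJ : ∀ J ≠ V, χ (φ (D.e J)) = 0)
    {i : Fin n} (hi : i ∉ V) {m : ℕ} (hm : m < n) : ¬ globalDimension B ≤ m := by
  intro hB
  let := Module.compHom k χ
  let F := ModuleCat.restrictScalars.{u} φ
  let Z : ModuleCat.{u} Bᵐᵒᵖ := ModuleCat.of Bᵐᵒᵖ k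
  have := h.preservesInjectiveObjects
  have hZ := hasInjectiveDimensionLE_obj F m Z
    (hasInjectiveDimensionLE_of_globalDimension_le hB Z)
  have hZ' := hasInjectiveDimensionLT_of_ge (F.obj Z) (m + 1) n hm
  refine CubeRing.not_hasInjectiveDimensionLT (D := D) (V := V) (Z := F.obj Z) (fun J hJV z => ?_)
    ⟨(1 : k), ?_⟩ hi hZ'
  · change χ (φ (D.e J)) * (show k from z) = 0
    rw [hJ J hJV, zero_mul]
  · change χ (φ (D.e V)) * 1 ≠ (0 : k)
    rw [hV, one_mul]
    exact one_ne_zero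

theorem isCentralLocalization_id (Q : Type u) [Ring Q] :
    IsCentralLocalization (⊥ : Submonoid Q) (RingHom.id Q) where
  comm := by simp [Submonoid.mem_bot]
  isUnit := by simp [Submonoid.mem_bot]
  surj x := ⟨1, one_mem _, x, by simp⟩
  exists_of_eq q r h := ⟨1, one_mem _, by simpa using h⟩

theorem isCentralLocalization_tensorProduct {R A : Type u} [CommRing R] [Ring A] [Algebra R A]
    (p : Ideal R) [p.IsPrime] :
    IsCentralLocalization (p.primeCompl.map (algebraMap R Aᵐᵒᵖ))
      (RingHom.op (Algebra.TensorProduct.includeRight :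
        A →ₐ[R] Localization.AtPrime p ⊗[R] A).toRingHom) where
  comm := by
    rintro _ ⟨r, -, rfl⟩ q
    exact Algebra.commutes r q
  isUnit := by
    rintro _ ⟨r, hr, rfl⟩
    have hu := (IsLocalization.map_units (Localization.AtPrime p) (⟨r, hr⟩ : p.primeCompl)).map
      (Algebra.TensorProduct.includeLeftRingHom :
        Localization.AtPrime p →+* Localization.AtPrime p ⊗[R] A)
    have : Algebra.TensorProduct.includeLeftRingHom (algebraMap R (Localization.AtPrime p) r) =
        (1 : Localization.AtPrime p) ⊗ₜ[R] (algebraMap R A r) := by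
      simp [Algebra.TensorProduct.includeLeftRingHom, Algebra.algebraMap_eq_smul_one]
    exact (this ▸ hu).op
  surj x := by
    obtain ⟨⟨a, s⟩, hs⟩ := IsLocalizedModule.surj p.primeCompl
      (TensorProduct.mk R (Localization.AtPrime p) A 1) x.unop
    refine ⟨_, ⟨s.1, s.2, rfl⟩, MulOpposite.op a, ?_⟩
    apply MulOpposite.unop_injective
    refine Eq.trans ?_ hs
    change x.unop * (1 : Localization.AtPrime p) ⊗ₜ[R] (algebraMap R A s.1) = _
    rw [Algebra.algebraMap_eq_smul_one, TensorProduct.tmul_smul, mul_smul_comm,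
      ← Algebra.TensorProduct.one_def, mul_one]
    rfl
  exists_of_eq q r hqr := by
    obtain ⟨s, hs⟩ := IsLocalizedModule.exists_of_eq (S := p.primeCompl)
      (f := TensorProduct.mk R (Localization.AtPrime p) A 1) (congrArg MulOpposite.unop hqr)
    refine ⟨_, ⟨s.1, s.2, rfl⟩, ?_⟩
    apply MulOpposite.unop_injective
    change q.unop * algebraMap R A s.1 = r.unop * algebraMap R A s.1
    rw [← Algebra.commutes, ← Algebra.commutes, ← Algebra.smul_def, ← Algebra.smul_def]
    exact hs

variable (k n) in
theorem ringKrullDim_NCRing_succ_le : ringKrullDim (NCRing k n) + 1 ≤ (n : WithBot ℕ∞) := by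
  have h := ringKrullDim_quotient_succ_le_of_nonZeroDivisor (r := squarefreeMonomial k
    (Finset.univ : Finset (Fin n))) (mem_nonZeroDivisors_of_ne_zero (squarefreeMonomial_ne_zero _))
  rwa [MvPolynomial.ringKrullDim_of_isNoetherianRing, ringKrullDim_eq_zero_of_field, zero_add,
    Nat.card_eq_fintype_card, Fintype.card_fin] at h

theorem ringKrullDim_localization_NCRing_le (hn : 1 ≤ n) (p : Ideal (NCRing k n)) [p.IsPrime] :
    ringKrullDim (Localization.AtPrime p) ≤ ((n - 1 : ℕ) : WithBot ℕ∞) := by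
  have h := ringKrullDim_NCRing_succ_le k n
  rw [IsLocalization.AtPrime.ringKrullDim_eq_height p (Localization.AtPrime p)]
  refine (Ideal.height_le_ringKrullDim_of_ne_top (Ideal.IsPrime.ne_top ‹_›)).trans ?_
  rw [← ENat.WithBot.add_le_add_one_right_iff]
  refine h.trans ?_
  rw [← Nat.cast_add_one, Nat.sub_add_cancel hn]

/-- Take for p the kernel of R → A → k; its complement maps to nonzero scalars, so the character
extends to A_p. -/
theorem exists_character_tensorProduct {R A : Type u} [CommRing R] [Ring A] [Algebra R A]
    (χ : Aᵐᵒᵖ →+* k) : ∃ p : PrimeSpectrum R,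
      ∃ χ' : (Localization.AtPrime p.asIdeal ⊗[R] A)ᵐᵒᵖ →+* k,
        ∀ a, χ' (RingHom.op (Algebra.TensorProduct.includeRight :
          A →ₐ[R] Localization.AtPrime p.asIdeal ⊗[R] A).toRingHom a) = χ a := by
  let χ₁ : A →+* k :=
    { toFun := fun a => χ (MulOpposite.op a)
      map_one' := χ.map_one
      map_mul' := fun a b => by rw [MulOpposite.op_mul, map_mul, mul_comm]
      map_zero' := χ.map_zero
      map_add' := fun a b => by rw [MulOpposite.op_add, map_add] }
  let := (χ₁.comp (algebraMap R A)).toAlgebra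
  let p : Ideal R := RingHom.ker (algebraMap R k)
  have hp : p.IsPrime := RingHom.ker_isPrime _
  let f : Localization.AtPrime p →ₐ[R] k :=
    IsLocalization.liftAlgHom (M := p.primeCompl) (f := Algebra.ofId R k)
      fun s => IsUnit.mk0 _ s.2
  let g : A →ₐ[R] k := { χ₁ with commutes' := fun _ => rfl }
  refine ⟨⟨p, hp⟩, (Algebra.TensorProduct.lift f g fun _ _ => Commute.all _ _).toRingHom.fromOpposite
      fun _ _ => Commute.all _ _, fun a => ?_⟩
  change Algebra.TensorProduct.lift f g (fun _ _ => Commute.all _ _) (1 ⊗ₜ[R] a.unop) = _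
  rw [Algebra.TensorProduct.lift_tmul, map_one, one_mul]
  rfl

/-- At the prime below a character, gldim A_p exceeds n - 1 ≥ dim R_p. A singleton vertex is
nonempty, giving the character, and proper because n ≥ 2. -/
theorem CubeRing.not_isNonsingularOrder {A : Type u} [Ring A] [Algebra (NCRing k n) A]
    (D : CubeRing k n Aᵐᵒᵖ) (hn : 2 ≤ n) : ¬ IsNonsingularOrder (NCRing k n) A := by
  intro hA
  obtain ⟨χ, hχ, hχ'⟩ := D.exists_character (V := {⟨0, by omega⟩}) (by simp)
  obtain ⟨p, χ', hg⟩ := exists_character_tensorProduct (R := NCRing k n) χ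
  refine D.not_globalDimension_le (isCentralLocalization_tensorProduct p.asIdeal) χ'
    ((hg _).trans hχ) (fun J hJ => (hg _).trans (hχ' J hJ)) (i := ⟨1, by omega⟩) (by simp)
    (m := n - 1) (by omega) ?_
  exact (hA.globalDimension_eq p).trans_le
    (ringKrullDim_localization_NCRing_le (by omega) p.asIdeal)

theorem CubeRing.le_globalDimension {A : Type u} [Ring A] (D : CubeRing k n Aᵐᵒᵖ) (hn : 2 ≤ n) :
    (n : WithBot ℕ∞) ≤ globalDimension A := by
  obtain ⟨χ, hχ, hχ'⟩ := D.exists_character (V := {⟨0, by omega⟩}) (by simp)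
  have h := D.not_globalDimension_le (isCentralLocalization_id _) χ hχ hχ' (i := ⟨1, by omega⟩)
    (by simp) (m := n - 1) (by omega)
  rw [not_le] at h
  have := ENat.WithBot.add_one_le_iff.2 h
  rwa [← Nat.cast_add_one, Nat.sub_add_cancel (by omega)] at this

theorem mem_support_cyclicModule {I : Finset (Fin n)} {p : PrimeSpectrum (NCRing k n)}
    (h : monomialClass k n I ∈ p.asIdeal) : p ∈ Module.support (NCRing k n) (CyclicModule k n I) := by
  have : p ∈ Module.support (NCRing k n) (NCRing k n ⧸ Ideal.span {monomialClass k n I}) := by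
    rw [Module.mem_support_iff_of_finite, Ideal.annihilator_quotient,
      Ideal.span_singleton_le_iff_mem]
    exact h
  exact this

theorem monomialClass_univ : monomialClass k n Finset.univ = 0 :=
  Ideal.Quotient.eq_zero_iff_mem.2 (Ideal.subset_span rfl)

/-- The summand R = R/(x_[n]) has full support. If it is the omitted one, every prime contains some
xᵢ, and {i} ≠ [n] because n ≥ 2. -/
theorem exists_monomialClass_mem (hn : 2 ≤ n) (K : Finset (Fin n))
    (p : PrimeSpectrum (NCRing k n)) : ∃ I ≠ K, monomialClass k n I ∈ p.asIdeal := by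
  have h0 : monomialClass k n Finset.univ ∈ p.asIdeal := by
    rw [monomialClass_univ]
    exact p.asIdeal.zero_mem
  by_cases hK : Finset.univ = K
  · subst hK
    rw [monomialClass, map_prod, Ideal.IsPrime.prod_mem_iff] at h0
    obtain ⟨i, -, hi⟩ := h0
    refine ⟨{i}, fun h => ?_, by simpa [monomialClass] using hi⟩
    have := congrArg Finset.card h
    simp at this
    omega
  · exact ⟨_, hK, h0⟩

theorem support_NCRing : Module.support (NCRing k n) (NCRing k n) = Set.univ := by
  rw [Set.eq_univ_iff_forall]
  intro p
  rw [Module.mem_support_iff_of_finite]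
  intro x hx
  have : x = 0 := by simpa using Module.mem_annihilator.1 hx 1
  exact this ▸ p.asIdeal.zero_mem

theorem support_fullModule :
    Module.support (NCRing k n) (FullModule k n) = Module.support (NCRing k n) (NCRing k n) := by
  rw [support_NCRing, Set.eq_univ_iff_forall]
  intro p
  exact Module.support_subset_of_injective
    (DirectSum.lof (NCRing k n) _ (CyclicModule k n) Finset.univ) (DirectSum.of_injective _)
    (mem_support_cyclicModule (by rw [monomialClass_univ]; exact p.asIdeal.zero_mem))

theorem support_omitModule (hn : 2 ≤ n) (K : Finset (Fin n)) :
    Module.support (NCRing k n) (OmitModule k n K) = Module.support (NCRing k n) (NCRing k n) := by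
  rw [support_NCRing, Set.eq_univ_iff_forall]
  intro p
  obtain ⟨I, hI, hp⟩ := exists_monomialClass_mem hn K p
  exact Module.support_subset_of_injective
    (DirectSum.lof (NCRing k n) _ (fun I : {I // I ≠ K} => CyclicModule k n I.1) ⟨I, hI⟩)
    (DirectSum.of_injective _) (mem_support_cyclicModule hp)

instance (I : Finset (Fin n)) : Module.Finite (NCRing k n) (CyclicModule k n I) :=
  inferInstanceAs (Module.Finite (NCRing k n) (NCRing k n ⧸ Ideal.span {monomialClass k n I}))

theorem globalDimension_end_full_le (hn : 1 ≤ n) :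
    globalDimension (Module.End (NCRing k n) (FullModule k n)) ≤ (n : WithBot ℕ∞) :=
  globalDimension_le_iff.2 fun X => pdLE_end_full hn X

theorem globalDimension_end_omit_le (hn : 1 ≤ n) (K : Finset (Fin n)) :
    globalDimension (Module.End (NCRing k n) (OmitModule k n K)) ≤
      ((2 * n - 1 : ℕ) : WithBot ℕ∞) :=
  globalDimension_le_iff.2 fun X => pdLE_end_omit hn K X

theorem natCast_withBot_lt_top (m : ℕ) : (m : WithBot ℕ∞) < ⊤ :=
  WithBot.coe_lt_coe.2 (ENat.natCast_lt_top m)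

end NormalCrossing

end

theorem mainTheorem12 (k : Type u) [Field k] (n : ℕ) (hn : 2 ≤ n) :
    (NormalCrossing.IsNCR (NormalCrossing.NCRing k n) (NormalCrossing.FullModule k n) ∧
      NormalCrossing.globalDimension
        (Module.End (NormalCrossing.NCRing k n) (NormalCrossing.FullModule k n)) =
          (n : WithBot ℕ∞) ∧
      ¬ NormalCrossing.IsNCCR (NormalCrossing.NCRing k n) (NormalCrossing.FullModule k n)) ∧
    ∀ K : Finset (Fin n),
      NormalCrossing.IsNCR (NormalCrossing.NCRing k n) (NormalCrossing.OmitModule k n K) ∧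
      NormalCrossing.globalDimension
        (Module.End (NormalCrossing.NCRing k n) (NormalCrossing.OmitModule k n K)) ≤
          ((2 * n - 1 : ℕ) : WithBot ℕ∞) := by
  have hn' : 1 ≤ n := by omega
  have hfull := NormalCrossing.globalDimension_end_full_le (k := k) hn'
  have homit := NormalCrossing.globalDimension_end_omit_le (k := k) hn'
  refine ⟨⟨⟨inferInstance, NormalCrossing.support_fullModule,
    hfull.trans_lt (NormalCrossing.natCast_withBot_lt_top n)⟩,
    hfull.antisymm ((NormalCrossing.fullCubeRing k n).le_globalDimension hn),
    fun h => (NormalCrossing.fullCubeRing k n).not_isNonsingularOrder hn h.isNonsingularOrder⟩,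
    fun K => ⟨⟨inferInstance, NormalCrossing.support_omitModule hn K,
      (homit K).trans_lt (NormalCrossing.natCast_withBot_lt_top _)⟩, homit K⟩⟩
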